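/- Setting. Let $d\ge 2$, $n,r,k\ge 0$ be integers and $L\ge R>0$; put $\mathcal D_L=[-L,L]^d$. Let $I_z\subset\mathbb R^n$ be the set of values of the random variable $z$. So that $z$-derivatives are meaningful, $I_z$ is contained in the closure of its interior and at each of its points the tangent directions span $\mathbb R^n$ (e.g. $I_z$ is open, or a box). At boundary points derivatives are taken within $I_z$. For multi-indices $l\in\mathbb N^n$ put $|l|=l_1+\dots+l_n$. The collision kernel is $\Phi(|q|)\,b(\sigma\cdot\hat q,z)$, where $\Phi\ge 0$ is measurable with $\|\mathbf 1_{|q|\le R}\Phi(|q|)\|_{L^\infty(\mathcal D_L)}\le M<\infty$, and $b(\cdot,z)$ is measurable on $[-1,1]$, $b>0$, $b(c,\cdot)\in C^r(I_z)$ with $|\partial_z^l b|\le C_b$ for all $|l|\le r$ (in particular $\int_{\mathbb S^{d-1}}b\,d\sigma<\infty$). With the symmetrized angular part $\tilde b(c,z)=[b(c,z)+b(-c,z)]\mathbf 1_{c\ge 0}$, let $$Q^R(g,f)(v,z)=\int_{|q|\le R}\int_{\mathbb S^{d-1}}\Phi(|q|)\,\tilde b(\sigma\cdot\hat q,z)\,\big[g(v'_*,z)f(v',z)-g(v-q,z)f(v,z)\big]\,d\sigma\,dq,$$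 $$v'=v-\tfrac{q-|q|\sigma}{2},\qquad v'_*=v-\tfrac{q+|q|\sigma}{2}.$$ Let $\Lambda\subset\mathbb Z^d$ be a finite set of frequencies (for instance $\{m:|m_1|+\dots+|m_d|\le N\}$), $\Phi_m(v)=e^{i\frac{\pi}{L}m\cdot v}$, and let $\mathcal P_N$ be the projection $\mathcal P_Ng=\sum_{m\in\Lambda}\langle g,\Phi_m\rangle\Phi_m$, where $\langle g,h\rangle=(2L)^{-d}\int_{\mathcal D_L}g\,\bar h\,dv$. Let $t_0\ge 0$ and let $f_N(t,v,z)=\sum_{m\in\Lambda}c_m(t,z)\Phi_m(v)$, with complex coefficients $c_m(\cdot,z)$ continuous on $[0,t_0]$ for each $z\in I_z$ and $c_m(t,\cdot)\in C^r(I_z)$ for each $t\in[0,t_0]$, solve $$\partial_t f_N=\mathcal P_NQ^R(f_N,f_N)\quad (0<t<t_0,\ z\in I_z),\qquad f_N(0,v,z)=f_N^0(v,z).$$ Norms: $\|g\|_{H^k_v}^2=\sum_{|\nu|\le k}\|\partial_v^\nu g\|_{L^2(\mathcal D_L)}^2$, and $$|g(\cdot,z)|_{L^1_v,r}=\sum_{|l|\le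 r}\|\partial_z^lg(\cdot,z)\|_{L^1(\mathcal D_L)},\quad |g(\cdot,z)|_{H^k_v,r}=\sum_{|l|\le r}\|\partial_z^lg(\cdot,z)\|_{H^k_v},\quad \|g\|_{H^k_v,r}=\sum_{|l|\le r}\sup_{z\in I_z}\|\partial_z^lg(\cdot,z)\|_{H^k_v}.$$ Proposition. For all families of constants $(E_l)$, $(D_l)$ there are constants $K_{k,l}$, $|l|\le r$, depending only on $d,n,r,k,R,L,M,C_b,t_0$ and the families $(E_l),(D_l)$ (in particular not on $\Lambda$, $z$ or $t$), such that: if for all $|l|\le r$ and $z\in I_z$ $$\|\partial_z^lf_N^0(\cdot,z)\|_{H^k_v}\le D_l\quad\text{and}\quad \|\partial_z^lf_N(t,\cdot,z)\|_{L^1(\mathcal D_L)}\le E_l\ \ \text{for all }t\in[0,t_0],$$ then $$\|\partial_z^lf_N(t,\cdot,z)\|_{H^k_v}\le K_{k,l}\qquad\text{for all }|l|\le r,\ t\in[0,t_0],\ z\in I_z.$$ Corollary. For all constants $E,D$ there is a constant $K_{k,r}$, depending only on $d,n,r,k,R,L,M,C_b,t_0,E,D$, such that: if $|f_N^0(\cdot,z)|_{H^k_v,r}\le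 D$ and $|f_N(t,\cdot,z)|_{L^1_v,r}\le E$ for all $t\in[0,t_0]$ and $z\in I_z$, then for all $t\in[0,t_0]$ $$|f_N(t,\cdot,z)|_{H^k_v,r}\le K_{k,r}\ \text{ for all }z\in I_z,\qquad\text{and}\qquad \|f_N(t,\cdot,\cdot)\|_{H^k_v,r}\le K_{k,r}.$$ -/

import Mathlib

open MeasureTheory Metric Set
open scoped ENNReal NNReal

noncomputable section

namespace SpectralBoltzmann

/-! ### Multi-indices and partial derivatives -/

/-- The multi-indices `l ∈ ℕ^m` with `|l| = l_1 + ... + l_m ≤ r`. -/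
def multiIdx (m r : ℕ) : Finset (Fin m → ℕ) :=
  (Fintype.piFinset fun _ => Finset.range (r + 1)).filter fun l => ∑ i, l i ≤ r

theorem mem_multiIdx {m r : ℕ} {l : Fin m → ℕ} : l ∈ multiIdx m r ↔ ∑ i, l i ≤ r := by
  simp only [multiIdx, Finset.mem_filter, Fintype.mem_piFinset, Finset.mem_range,
    and_iff_right_iff_imp]
  intro h i
  exact Nat.lt_succ_of_le ((Finset.single_le_sum (fun _ _ => Nat.zero_le _)
    (Finset.mem_univ i)).trans h)

/-- The partial derivative in the `i`-th coordinate of a function on `S ⊆ ℝ^m`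
(at a boundary point of `S` the derivative is taken within `S`). -/
def partialWithin {m : ℕ} (S : Set (EuclideanSpace ℝ (Fin m))) (i : Fin m)
    (g : EuclideanSpace ℝ (Fin m) → ℂ) : EuclideanSpace ℝ (Fin m) → ℂ :=
  fun x => fderivWithin ℝ g S x (EuclideanSpace.single i 1)

/-- The mixed partial derivative `∂^l = ∂_1^{l_1} ⋯ ∂_m^{l_m}` of a function on `S ⊆ ℝ^m`. -/
def multiDeriv {m : ℕ} (S : Set (EuclideanSpace ℝ (Fin m))) (l : Fin m → ℕ)
    (g : EuclideanSpace ℝ (Fin m) → ℂ) : EuclideanSpace ℝ (Fin m) → ℂ :=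
  (List.finRange m).foldr (fun i h => (partialWithin S i)^[l i] h) g

/-- For `g = g(v, z)`, the derivative `∂_z^l g`, with `z` ranging over `Iz`. -/
def zDeriv {d n : ℕ} (Iz : Set (EuclideanSpace ℝ (Fin n))) (l : Fin n → ℕ)
    (g : EuclideanSpace ℝ (Fin d) → EuclideanSpace ℝ (Fin n) → ℂ) :
    EuclideanSpace ℝ (Fin d) → EuclideanSpace ℝ (Fin n) → ℂ :=
  fun v z => multiDeriv Iz l (g v) z

/-! ### Norms -/

/-- The velocity domain `D_L = [-L, L]^d`. -/
def velocityBox (d : ℕ) (L : ℝ) : Set (EuclideanSpace ℝ (Fin d)) :=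
  {v | ∀ i, v i ∈ Icc (-L) L}

/-- `‖g‖_{L^p(D_L)}`. -/
def normLp {d : ℕ} (L : ℝ) (p : ℝ≥0∞) (g : EuclideanSpace ℝ (Fin d) → ℂ) : ℝ≥0∞ :=
  eLpNorm g p (volume.restrict (velocityBox d L))

/-- `‖g‖_{H^k(D_L)} = (∑_{|ν| ≤ k} ‖∂_v^ν g‖²_{L²(D_L)})^{1/2}`; it is used for trigonometric
polynomials only, which are smooth, so the derivatives are classical. -/
def normHk {d : ℕ} (L : ℝ) (k : ℕ) (g : EuclideanSpace ℝ (Fin d) → ℂ) : ℝ≥0∞ :=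
  (∑ ν ∈ multiIdx d k, normLp L 2 (multiDeriv univ ν g) ^ 2) ^ (1 / 2 : ℝ)

/-- `|g(·, z)|_{L^p_v, r} = ∑_{|l| ≤ r} ‖∂_z^l g(·, z)‖_{L^p(D_L)}`. -/
def normLpSum {d n : ℕ} (Iz : Set (EuclideanSpace ℝ (Fin n))) (L : ℝ) (p : ℝ≥0∞) (r : ℕ)
    (g : EuclideanSpace ℝ (Fin d) → EuclideanSpace ℝ (Fin n) → ℂ)
    (z : EuclideanSpace ℝ (Fin n)) : ℝ≥0∞ :=
  ∑ l ∈ multiIdx n r, normLp L p fun v => zDeriv Iz l g v z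

/-- `|g(·, z)|_{H^k_v, r} = ∑_{|l| ≤ r} ‖∂_z^l g(·, z)‖_{H^k(D_L)}`. -/
def normHkSum {d n : ℕ} (Iz : Set (EuclideanSpace ℝ (Fin n))) (L : ℝ) (k r : ℕ)
    (g : EuclideanSpace ℝ (Fin d) → EuclideanSpace ℝ (Fin n) → ℂ)
    (z : EuclideanSpace ℝ (Fin n)) : ℝ≥0∞ :=
  ∑ l ∈ multiIdx n r, normHk L k fun v => zDeriv Iz l g v z

/-- `‖g‖_{H^k_v, r} = ∑_{|l| ≤ r} sup_{z ∈ Iz} ‖∂_z^l g(·, z)‖_{H^k(D_L)}`. -/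
def supNormHkSum {d n : ℕ} (Iz : Set (EuclideanSpace ℝ (Fin n))) (L : ℝ) (k r : ℕ)
    (g : EuclideanSpace ℝ (Fin d) → EuclideanSpace ℝ (Fin n) → ℂ) : ℝ≥0∞ :=
  ∑ l ∈ multiIdx n r, ⨆ z ∈ Iz, normHk L k fun v => zDeriv Iz l g v z

/-! ### The collision operator -/

/-- The symmetrized angular part
`[b(cos θ) + b(cos (π - θ))] 1_{0 ≤ θ ≤ π/2}` as a function of `c = cos θ`. -/
def symmAngular (b : ℝ → ℝ) (c : ℝ) : ℝ :=
  if 0 ≤ c then b c + b (-c) else 0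

/-- The truncated collision operator
`Q^R(g, f)(v) = ∫_{|q| ≤ R} ∫_{S^{d-1}} Φ(|q|) b(σ ⋅ q̂) [g(v'_*) f(v') - g(v - q) f(v)] dσ dq`
with `v' = v - (q - |q| σ) / 2`, `v'_* = v - (q + |q| σ) / 2`, and the symmetrized angular part,
for one fixed value of the random variable. -/
def collision {d : ℕ} (R : ℝ) (Φ : ℝ → ℝ) (b : ℝ → ℝ)
    (g f : EuclideanSpace ℝ (Fin d) → ℂ) (v : EuclideanSpace ℝ (Fin d)) : ℂ :=
  ∫ q in closedBall (0 : EuclideanSpace ℝ (Fin d)) R,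
    ∫ σ : sphere (0 : EuclideanSpace ℝ (Fin d)) 1,
      ((Φ ‖q‖ * symmAngular b (inner ℝ (σ : EuclideanSpace ℝ (Fin d)) (‖q‖⁻¹ • q)) : ℝ) : ℂ) *
        (g (v - (1 / 2 : ℝ) • (q + ‖q‖ • (σ : EuclideanSpace ℝ (Fin d)))) *
            f (v - (1 / 2 : ℝ) • (q - ‖q‖ • (σ : EuclideanSpace ℝ (Fin d)))) -
          g (v - q) * f v)
      ∂(volume : Measure (EuclideanSpace ℝ (Fin d))).toSphere

/-- The assumptions on the kernel `B = Φ(|q|) b(σ ⋅ q̂, z)`: the kinetic part is nonnegative with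
`‖1_{|q| ≤ R} Φ(|q|)‖_{L^∞(D_L)} ≤ M`; the angular part is measurable in `cos θ`, positive, and
`r` times continuously differentiable in `z`, with `|∂_z^l b| ≤ Cb` for `|l| ≤ r`. The last bound
with `l = 0` contains the cut-off assumption `∫_{S^{d-1}} b(cos θ, z) dσ < ∞`. -/
structure KernelAssumptions (d : ℕ) {n : ℕ} (r : ℕ) (R L : ℝ)
    (Iz : Set (EuclideanSpace ℝ (Fin n))) (M Cb : ℝ≥0)
    (Φ : ℝ → ℝ) (b : ℝ → EuclideanSpace ℝ (Fin n) → ℝ) : Prop where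
  kinetic_nonneg : ∀ s, 0 ≤ s → 0 ≤ Φ s
  kinetic_measurable : Measurable Φ
  kinetic_bound :
    eLpNorm ((closedBall (0 : EuclideanSpace ℝ (Fin d)) R).indicator fun q => Φ ‖q‖) ∞
      (volume.restrict (velocityBox d L)) ≤ M
  angular_measurable : ∀ z ∈ Iz, Measurable fun c => b c z
  angular_pos : ∀ c ∈ Icc (-1 : ℝ) 1, ∀ z ∈ Iz, 0 < b c z
  angular_contDiff : ∀ c ∈ Icc (-1 : ℝ) 1, ContDiffOn ℝ r (b c) Iz
  angular_bound : ∀ c ∈ Icc (-1 : ℝ) 1, ∀ z ∈ Iz, ∀ l ∈ multiIdx n r,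
    ‖multiDeriv Iz l (fun y => (b c y : ℂ)) z‖ ≤ Cb

/-! ### The Fourier–Galerkin system -/

/-- `Φ_m(v) = exp(i (π / L) m ⋅ v)`. -/
def fourierMode {d : ℕ} (L : ℝ) (m : Fin d → ℤ) (v : EuclideanSpace ℝ (Fin d)) : ℂ :=
  Complex.exp (Complex.I * ((Real.pi / L * ∑ i, (m i : ℝ) * v i : ℝ) : ℂ))

/-- The Fourier coefficient `⟨g, Φ_m⟩ = (2L)^{-d} ∫_{D_L} g(v) conj(Φ_m(v)) dv`. -/
def fourierCoefficient {d : ℕ} (L : ℝ) (g : EuclideanSpace ℝ (Fin d) → ℂ) (m : Fin d → ℤ) : ℂ :=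
  ((((2 * L) ^ d)⁻¹ : ℝ) : ℂ) *
    ∫ v in velocityBox d L, g v * (starRingEnd ℂ) (fourierMode L m v)

/-- The truncated Fourier series
`f_N(t, v, z) = ∑_{m ∈ Λ} c_m(t, z) Φ_m(v)` with coefficients `c t z m`. -/
def truncatedSeries {d n : ℕ} (L : ℝ) (Λ : Finset (Fin d → ℤ))
    (c : ℝ → EuclideanSpace ℝ (Fin n) → (Fin d → ℤ) → ℂ) (t : ℝ)
    (v : EuclideanSpace ℝ (Fin d)) (z : EuclideanSpace ℝ (Fin n)) : ℂ :=
  ∑ m ∈ Λ, c t z m * fourierMode L m v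

/-- The coefficients `c` are a solution on `[0, t₀]` of the numerical system
`∂_t f_N = P_N Q^R(f_N, f_N)`, where `P_N` is the orthogonal projection onto the span of the modes
in `Λ`; as both sides are in this span, this is the system
`∂_t c_m = ⟨Q^R(f_N, f_N), Φ_m⟩`, `m ∈ Λ`. The solution is continuous up to the end points, and
it has the `z`-derivatives up to the order `r`. -/
structure IsNumericalSolution {d n : ℕ} (r : ℕ) (R L : ℝ) (Iz : Set (EuclideanSpace ℝ (Fin n)))
    (Φ : ℝ → ℝ) (b : ℝ → EuclideanSpace ℝ (Fin n) → ℝ) (Λ : Finset (Fin d → ℤ)) (t₀ : ℝ)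
    (c : ℝ → EuclideanSpace ℝ (Fin n) → (Fin d → ℤ) → ℂ) : Prop where
  continuousOn : ∀ z ∈ Iz, ∀ m ∈ Λ, ContinuousOn (fun t => c t z m) (Icc 0 t₀)
  equation : ∀ t ∈ Ioo 0 t₀, ∀ z ∈ Iz, ∀ m ∈ Λ,
    HasDerivAt (fun s => c s z m)
      (fourierCoefficient L
        (collision R Φ (fun x => b x z)
          (fun v => truncatedSeries L Λ c t v z) (fun v => truncatedSeries L Λ c t v z)) m) t
  contDiffOn : ∀ t ∈ Icc 0 t₀, ∀ m ∈ Λ, ContDiffOn ℝ r (fun z => c t z m) Iz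

end SpectralBoltzmann

end

/-!
The system is studied through the Fourier coefficients. On trigonometric polynomials the collision
operator is a bilinear form `∑_{p+q=m} β(p, q) x_p y_q`, since `Φ_p(v'_*) Φ_q(v')` is a multiple of
`Φ_{p+q}(v)`, and `∂_v^s` is the multiplication by a factor that is a product of additive functions
of the frequency. Hence the coefficients of `∂_v^s ∂_z^w f_N` satisfy equations whose right-hand
sides are Leibniz sums of such forms, with the angular part replaced by its `z`-derivatives.

*The bilinear estimate* (`coeffNorm_galerkinForm_le`). The projected collision operator maps
`L¹ × L²` to `L²` with a constant that does not depend on `Λ`. By duality it is enough to test it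
against a trigonometric polynomial `h`. In the gain term, put `u = v'_*`; then `v' = u + |ξ| σ` and
`v = u + (ξ + |ξ| σ) / 2`. For fixed `u`, Cauchy–Schwarz in `(ξ, σ)` separates `f` and `h`: the
factor with `f` is computed in polar coordinates (`lintegral_norm_smul_sphere`), the factor with `h`
by the substitution `y = (ξ + |ξ| σ) / 2`, whose Jacobian is bounded below because the symmetrized
kernel lives on `σ ⋅ ξ ≥ 0` (`lintegral_half_add_norm_smul_le`). As `R ≤ L`, a ball of radius `R`
is contained in one period.

*Differentiation in `z`* (`coeffDeriv_eq_add_integral`). The coefficients are assumed to be `C^r` in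
`z` only for each fixed time. The `L¹` bounds on the derivatives bound the derivatives of the
coefficients uniformly in `t` and `z`, so that the integrated equation can be differentiated by
dominated convergence at interior points of `I_z`, one derivative at a time. The final bounds extend
to all of `I_z` by continuity. Derivatives are indexed by sorted words of letters, which makes the
Leibniz rule a sum over the splittings of a word into two subwords.

*The induction* (`exists_bound_of_hierarchy`). In the equation for `∂_v^s ∂_z^w f_N` every term is a
product of two derivatives. If both have lower order, it is bounded by induction. Otherwise it is
linear in `∂_v^s ∂_z^w f_N`, and the other factor is `f_N` itself: its `L¹` norm enters where
`∂_v^s ∂_z^w f_N` is measured in `L²`, and its `L²` norm, known from the lowest order, where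
`∂_v^s ∂_z^w f_N` is measured in `L¹`. Grönwall's inequality closes the step.
-/

noncomputable section

open scoped Pointwise

namespace SpectralBoltzmann

/-! ### Words of derivatives and the Leibniz rule -/

section

/-- The iterated partial derivative `∂_{i_1} ⋯ ∂_{i_j} g` on `S` for the word
`w = [i_1, …, i_j]`. -/
def wordDeriv {m : ℕ} (S : Set (EuclideanSpace ℝ (Fin m))) (w : List (Fin m))
    (g : EuclideanSpace ℝ (Fin m) → ℂ) : EuclideanSpace ℝ (Fin m) → ℂ :=
  w.foldr (partialWithin S) g

/-- The sorted word `1^{l_1} ⋯ m^{l_m}` of a multi-index `l`. -/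
def wordOf {m : ℕ} (l : Fin m → ℕ) : List (Fin m) :=
  (List.finRange m).flatMap fun i => List.replicate (l i) i

/-- All ways to distribute the letters of a word over two subwords, with multiplicity. -/
def splits {α : Type*} : List α → List (List α × List α)
  | [] => [([], [])]
  | i :: w => (splits w).map (fun p => (i :: p.1, p.2)) ++ (splits w).map fun p => (p.1, i :: p.2)

variable {m : ℕ} {S : Set (EuclideanSpace ℝ (Fin m))}

@[simp] theorem wordDeriv_nil (g : EuclideanSpace ℝ (Fin m) → ℂ) : wordDeriv S [] g = g := rfl

theorem wordDeriv_cons (i : Fin m) (w : List (Fin m)) (g : EuclideanSpace ℝ (Fin m) → ℂ) :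
    wordDeriv S (i :: w) g = partialWithin S i (wordDeriv S w g) := rfl

theorem multiDeriv_eq_wordDeriv (l : Fin m → ℕ) (g : EuclideanSpace ℝ (Fin m) → ℂ) :
    multiDeriv S l g = wordDeriv S (wordOf l) g := by
  have key (j : ℕ) (i : Fin m) (h : EuclideanSpace ℝ (Fin m) → ℂ) :
      (partialWithin S i)^[j] h = (List.replicate j i).foldr (partialWithin S) h := by
    induction j with
    | zero => rfl
    | succ j ih => rw [Function.iterate_succ_apply', ih, List.replicate_succ, List.foldr_cons]
  unfold multiDeriv wordDeriv wordOf
  simp only [key, List.foldr_flatMap]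

theorem length_wordOf (l : Fin m → ℕ) : (wordOf l).length = ∑ i, l i := by
  simp [wordOf, List.length_flatMap, Fin.sum_univ_def]

theorem pairwise_wordOf (l : Fin m → ℕ) : (wordOf l).Pairwise (· ≤ ·) := by
  rw [wordOf, List.pairwise_flatMap]
  refine ⟨fun i _ => by simp [List.pairwise_replicate], ?_⟩
  refine (List.pairwise_lt_finRange m).imp fun {a b} hab x hx y hy => ?_
  rw [List.eq_of_mem_replicate hx, List.eq_of_mem_replicate hy]
  exact hab.le

/-- A sorted word is the word of the multi-index that counts its letters. -/
theorem exists_eq_wordOf {w : List (Fin m)} (hw : w.Pairwise (· ≤ ·)) : ∃ l, w = wordOf l := by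
  refine ⟨fun i => w.count i, List.Perm.eq_of_pairwise' hw (pairwise_wordOf _) ?_⟩
  rw [List.perm_iff_count]
  intro a
  rw [wordOf, List.count_flatMap]
  have : (List.count a ∘ fun i => List.replicate (List.count i w) i)
      = fun i => if i = a then List.count i w else 0 := by
    funext i; simp [List.count_replicate]
  rw [this, ← Fin.sum_univ_def]
  simp

theorem length_add_length_of_mem_splits {α : Type*} {w : List α} {p : List α × List α}
    (hp : p ∈ splits w) : p.1.length + p.2.length = w.length := by
  induction w generalizing p with
  | nil => simp_all [splits]
  | cons i w ih =>
    simp only [splits, List.mem_append, List.mem_map] at hp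
    rcases hp with ⟨q, hq, rfl⟩ | ⟨q, hq, rfl⟩ <;> have := ih hq <;> simp <;> omega

theorem sublist_of_mem_splits {α : Type*} {w : List α} {p : List α × List α}
    (hp : p ∈ splits w) : p.1.Sublist w ∧ p.2.Sublist w := by
  induction w generalizing p with
  | nil => simp_all [splits]
  | cons i w ih =>
    simp only [splits, List.mem_append, List.mem_map] at hp
    rcases hp with ⟨q, hq, rfl⟩ | ⟨q, hq, rfl⟩
    · exact ⟨(ih hq).1.cons_cons i, (ih hq).2.cons i⟩
    · exact ⟨(ih hq).1.cons i, (ih hq).2.cons_cons i⟩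

/-- The product over a word of sums of two factors, expanded. -/
theorem prod_map_add_eq_sum_splits {α R : Type*} [CommSemiring R] (f g : α → R) (w : List α) :
    (w.map fun i => f i + g i).prod
      = ((splits w).map fun p => (p.1.map f).prod * (p.2.map g).prod).sum := by
  induction w with
  | nil => simp [splits]
  | cons i w ih =>
    simp only [List.map_cons, List.prod_cons, ih, splits, List.map_append, List.map_map,
      List.sum_append, Function.comp_def, add_mul]
    congr 1
    · simp only [mul_assoc, List.sum_map_mul_left]
    · simp only [mul_left_comm _ (g i), List.sum_map_mul_left]

theorem partialWithin_congr {f g : EuclideanSpace ℝ (Fin m) → ℂ} (h : EqOn f g S) (i : Fin m) :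
    EqOn (partialWithin S i f) (partialWithin S i g) S := fun x hx => by
  simp only [partialWithin, fderivWithin_congr h (h hx)]

theorem contDiffOn_partialWithin (hS : UniqueDiffOn ℝ S) {j : ℕ}
    {g : EuclideanSpace ℝ (Fin m) → ℂ} (hg : ContDiffOn ℝ (j + 1 : ℕ) g S) (i : Fin m) :
    ContDiffOn ℝ j (partialWithin S i g) S := by
  have := hg.fderivWithin hS (m := (j : WithTop ℕ∞)) (by norm_cast)
  exact this.clm_apply contDiffOn_const

theorem contDiffOn_wordDeriv (hS : UniqueDiffOn ℝ S) {r j : ℕ} {w : List (Fin m)}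
    {g : EuclideanSpace ℝ (Fin m) → ℂ} (hg : ContDiffOn ℝ r g S) (hw : w.length + j ≤ r) :
    ContDiffOn ℝ j (wordDeriv S w g) S := by
  induction w generalizing j with
  | nil => exact hg.of_le (by simp at hw; exact_mod_cast hw)
  | cons i w ih =>
    exact contDiffOn_partialWithin hS (ih (by simp at hw; omega)) i

theorem differentiableOn_wordDeriv (hS : UniqueDiffOn ℝ S) {r : ℕ} {w : List (Fin m)}
    {g : EuclideanSpace ℝ (Fin m) → ℂ} (hg : ContDiffOn ℝ r g S) (hw : w.length < r) :
    DifferentiableOn ℝ (wordDeriv S w g) S :=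
  (contDiffOn_wordDeriv hS hg (j := 1) hw).differentiableOn (by simp)

theorem partialWithin_mul {x : EuclideanSpace ℝ (Fin m)}
    (hS : UniqueDiffOn ℝ S) (hx : x ∈ S) (i : Fin m) {f g : EuclideanSpace ℝ (Fin m) → ℂ}
    (hf : DifferentiableOn ℝ f S) (hg : DifferentiableOn ℝ g S) :
    partialWithin S i (fun y => f y * g y) x
      = partialWithin S i f x * g x + f x * partialWithin S i g x := by
  simp only [partialWithin]
  rw [fderivWithin_fun_mul (hS x hx) (hf x hx) (hg x hx)]
  simp; ring

theorem partialWithin_list_sum {x : EuclideanSpace ℝ (Fin m)}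
    (hS : UniqueDiffOn ℝ S) (hx : x ∈ S) (i : Fin m) {ι : Type*} (L : List ι)
    (f : ι → EuclideanSpace ℝ (Fin m) → ℂ) (hf : ∀ a ∈ L, DifferentiableOn ℝ (f a) S) :
    partialWithin S i (fun y => (L.map fun a => f a y).sum) x
      = (L.map fun a => partialWithin S i (f a) x).sum := by
  suffices DifferentiableOn ℝ (fun y => (L.map fun a => f a y).sum) S ∧
    partialWithin S i (fun y => (L.map fun a => f a y).sum) x
      = (L.map fun a => partialWithin S i (f a) x).sum from this.2
  induction L with
  | nil => simp [partialWithin, differentiableOn_const]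
  | cons a L ih =>
    obtain ⟨h1, h2⟩ := ih fun b hb => hf b (List.mem_cons_of_mem _ hb)
    have ha := hf a List.mem_cons_self
    simp only [List.map_cons, List.sum_cons]
    refine ⟨ha.add h1, ?_⟩
    rw [← h2]
    simp only [partialWithin]
    rw [fderivWithin_fun_add (hS x hx) (ha x hx) (h1 x hx)]
    simp

theorem partialWithin_sum {x : EuclideanSpace ℝ (Fin m)}
    (hS : UniqueDiffOn ℝ S) (hx : x ∈ S) (i : Fin m) {ι : Type*} (L : Finset ι)
    (f : ι → EuclideanSpace ℝ (Fin m) → ℂ) (hf : ∀ a ∈ L, DifferentiableOn ℝ (f a) S) :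
    partialWithin S i (fun y => ∑ a ∈ L, f a y) x = ∑ a ∈ L, partialWithin S i (f a) x := by
  simp only [partialWithin]
  rw [fderivWithin_fun_sum (hS x hx) fun a ha => hf a ha x hx]
  simp

theorem partialWithin_const_mul {x : EuclideanSpace ℝ (Fin m)}
    (hS : UniqueDiffOn ℝ S) (hx : x ∈ S) (i : Fin m) (a : ℂ) {f : EuclideanSpace ℝ (Fin m) → ℂ}
    (hf : DifferentiableOn ℝ f S) :
    partialWithin S i (fun y => a * f y) x = a * partialWithin S i f x := by
  simp only [partialWithin]
  rw [fderivWithin_const_mul (hS x hx) (hf x hx)]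
  simp

theorem wordDeriv_sum_const_mul (hS : UniqueDiffOn ℝ S) {r : ℕ} {ι : Type*} (L : Finset ι)
    (a : ι → ℂ) (f : ι → EuclideanSpace ℝ (Fin m) → ℂ) (hf : ∀ j ∈ L, ContDiffOn ℝ r (f j) S)
    {w : List (Fin m)} (hw : w.length ≤ r) :
    EqOn (wordDeriv S w fun y => ∑ j ∈ L, a j * f j y)
      (fun y => ∑ j ∈ L, a j * wordDeriv S w (f j) y) S := by
  induction w with
  | nil => exact fun _ _ => rfl
  | cons i w ih =>
    have hd j (hj : j ∈ L) := differentiableOn_wordDeriv hS (hf j hj) (w := w) hw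
    intro x hx
    rw [wordDeriv_cons, partialWithin_congr (ih (by simp at hw; omega)) i hx,
      partialWithin_sum hS hx i L (fun j y => a j * wordDeriv S w (f j) y)
      (fun j hj => (hd j hj).const_mul _)]
    exact Finset.sum_congr rfl fun j hj => partialWithin_const_mul hS hx i _ (hd j hj)

theorem wordDeriv_mul (hS : UniqueDiffOn ℝ S) {r : ℕ} {f g : EuclideanSpace ℝ (Fin m) → ℂ}
    (hf : ContDiffOn ℝ r f S) (hg : ContDiffOn ℝ r g S) {w : List (Fin m)} (hw : w.length ≤ r) :
    EqOn (wordDeriv S w fun y => f y * g y)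
      (fun y => ((splits w).map fun p => wordDeriv S p.1 f y * wordDeriv S p.2 g y).sum) S := by
  induction w with
  | nil => intro x _; simp [splits]
  | cons i w ih =>
    intro x hx
    simp only [List.length_cons] at hw
    have hd p (hp : p ∈ splits w) : DifferentiableOn ℝ (wordDeriv S p.1 f) S ∧
        DifferentiableOn ℝ (wordDeriv S p.2 g) S := by
      have := length_add_length_of_mem_splits hp
      exact ⟨differentiableOn_wordDeriv hS hf (by omega),
        differentiableOn_wordDeriv hS hg (by omega)⟩
    rw [wordDeriv_cons, partialWithin_congr (ih (by omega)) i hx,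
      partialWithin_list_sum hS hx i (splits w)
      (fun p y => wordDeriv S p.1 f y * wordDeriv S p.2 g y)
      (fun p hp => (hd p hp).1.mul (hd p hp).2)]
    simp only [splits, List.map_append, List.map_map, List.sum_append, Function.comp_def,
      wordDeriv_cons]
    rw [← List.sum_map_add]
    refine congrArg List.sum (List.map_congr_left fun p hp => ?_)
    exact partialWithin_mul hS hx i (hd p hp).1 (hd p hp).2

theorem norm_list_sum_map_le {ι V : Type*} [SeminormedAddCommGroup V] (L : List ι) (f : ι → V)
    (g : ι → ℝ) (h : ∀ a ∈ L, ‖f a‖ ≤ g a) : ‖(L.map f).sum‖ ≤ (L.map g).sum := by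
  induction L with
  | nil => simp
  | cons a L ih =>
    simp only [List.map_cons, List.sum_cons]
    exact (norm_add_le _ _).trans (add_le_add (h a List.mem_cons_self)
      (ih fun b hb => h b (List.mem_cons_of_mem _ hb)))

end

/-! ### Periodic functions and Fourier modes on the velocity box -/

section

/-- Functions on `ℝ^d` with the period `2L` in each coordinate. -/
def BoxPeriodic {d : ℕ} {β : Type*} (L : ℝ) (F : EuclideanSpace ℝ (Fin d) → β) : Prop :=
  ∀ v j, F (v + EuclideanSpace.single j (2 * L)) = F v

theorem BoxPeriodic.comp_add {d : ℕ} {β : Type*} {L : ℝ} {F : EuclideanSpace ℝ (Fin d) → β}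
    (hF : BoxPeriodic L F) (a : EuclideanSpace ℝ (Fin d)) : BoxPeriodic L fun v => F (v + a) := by
  intro v j
  simpa only [add_right_comm] using hF (v + a) j

theorem BoxPeriodic.comp {d : ℕ} {β γ : Type*} {L : ℝ} {F : EuclideanSpace ℝ (Fin d) → β}
    (hF : BoxPeriodic L F) (G : β → γ) : BoxPeriodic L fun v => G (F v) :=
  fun v j => congrArg G (hF v j)

/-- The basis `2L e_1, …, 2L e_d` of the period lattice. -/
def boxBasis (d : ℕ) {L : ℝ} (hL : 0 < L) :
    Module.Basis (Fin d) ℝ (EuclideanSpace ℝ (Fin d)) :=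
  (EuclideanSpace.basisFun (Fin d) ℝ).toBasis.isUnitSMul (w := fun _ => 2 * L)
    fun _ => (by positivity : (2 * L) ≠ 0).isUnit

theorem boxBasis_apply (d : ℕ) {L : ℝ} (hL : 0 < L) (j : Fin d) :
    boxBasis d hL j = EuclideanSpace.single j (2 * L) := by
  rw [boxBasis, Module.Basis.isUnitSMul_apply]
  ext i
  simp

theorem boxBasis_repr (d : ℕ) {L : ℝ} (hL : 0 < L) (x : EuclideanSpace ℝ (Fin d)) (j : Fin d) :
    (boxBasis d hL).repr x j = (2 * L)⁻¹ * x j := by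
  rw [boxBasis, Module.Basis.repr_isUnitSMul, Units.smul_def]
  simp

/-- The lattice of the periods. -/
abbrev periodLattice (d : ℕ) {L : ℝ} (hL : 0 < L) : AddSubgroup (EuclideanSpace ℝ (Fin d)) :=
  (Submodule.span ℤ (range (boxBasis d hL))).toAddSubgroup

instance (d : ℕ) {L : ℝ} (hL : 0 < L) : Countable (periodLattice d hL) :=
  inferInstanceAs (Countable (Submodule.span ℤ (range (boxBasis d hL))))

theorem BoxPeriodic.vadd {d : ℕ} {β : Type*} {L : ℝ} (hL : 0 < L)
    {F : EuclideanSpace ℝ (Fin d) → β} (hF : BoxPeriodic L F) (g : periodLattice d hL)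
    (x : EuclideanSpace ℝ (Fin d)) : F (g +ᵥ x) = F x := by
  obtain ⟨g, hg⟩ := g
  rw [AddSubgroup.vadd_def, vadd_eq_add]
  change F (g + x) = F x
  rw [Submodule.mem_toAddSubgroup] at hg
  induction hg using Submodule.span_induction generalizing x with
  | mem y hy =>
    obtain ⟨j, rfl⟩ := hy
    rw [boxBasis_apply, add_comm, hF]
  | zero => rw [zero_add]
  | add y z _ _ h1 h2 => rw [add_assoc, h1, h2]
  | smul n y _ h =>
    induction n using Int.induction_on generalizing x with
    | zero => simp
    | succ n ih => rw [add_smul, one_smul, add_assoc, ih, h]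
    | pred n ih =>
      rw [← h, sub_smul, one_smul, ← add_assoc, add_sub_cancel, ih]

theorem velocityBox_eq_preimage (d : ℕ) (L : ℝ) :
    velocityBox d L = WithLp.ofLp ⁻¹' (Icc (fun _ : Fin d => -L) fun _ => L) := by
  ext v
  simp [velocityBox, Pi.le_def, forall_and]

theorem measurableSet_velocityBox (d : ℕ) (L : ℝ) : MeasurableSet (velocityBox d L) := by
  rw [velocityBox_eq_preimage]
  exact (PiLp.volume_preserving_ofLp (Fin d)).measurable measurableSet_Icc

theorem volume_velocityBox (d : ℕ) {L : ℝ} (hL : 0 < L) :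
    volume (velocityBox d L) = ENNReal.ofReal ((2 * L) ^ d) := by
  rw [velocityBox_eq_preimage,
    (PiLp.volume_preserving_ofLp (Fin d)).measure_preimage
      measurableSet_Icc.nullMeasurableSet, Real.volume_Icc_pi]
  simp only [Finset.prod_const, Finset.card_univ, Fintype.card_fin]
  rw [ENNReal.ofReal_pow (by positivity)]
  congr 2; ring

theorem isFiniteMeasure_velocityBox (d : ℕ) {L : ℝ} (hL : 0 < L) :
    IsFiniteMeasure (volume.restrict (velocityBox d L)) :=
  ⟨by rw [Measure.restrict_apply_univ, volume_velocityBox d hL]; exact ENNReal.ofReal_lt_top⟩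

theorem isCompact_velocityBox (d : ℕ) (L : ℝ) : IsCompact (velocityBox d L) := by
  have := (isCompact_Icc (a := fun _ : Fin d => -L) (b := fun _ => L)).image
    (PiLp.continuous_toLp 2 fun _ : Fin d => ℝ)
  convert this using 1
  ext v
  rw [velocityBox_eq_preimage]
  constructor
  · intro h; exact ⟨_, h, rfl⟩
  · rintro ⟨y, hy, rfl⟩; exact hy

/-- The closed box differs from a translate of the half-open fundamental domain of the period
lattice by a null set. -/
theorem isAddFundamentalDomain_velocityBox (d : ℕ) {L : ℝ} (hL : 0 < L) :
    IsAddFundamentalDomain (periodLattice d hL) (velocityBox d L)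
      (volume : Measure (EuclideanSpace ℝ (Fin d))) := by
  set a : EuclideanSpace ℝ (Fin d) := WithLp.toLp 2 fun _ => -L
  have h0 := (ZSpan.isAddFundamentalDomain' (boxBasis d hL)
    (volume : Measure (EuclideanSpace ℝ (Fin d)))).vadd_of_comm a
  have h1 : a +ᵥ ZSpan.fundamentalDomain (boxBasis d hL)
      = WithLp.ofLp ⁻¹' (univ.pi fun _ : Fin d => Ico (-L) L) := by
    ext v
    rw [mem_vadd_set_iff_neg_vadd_mem, ZSpan.mem_fundamentalDomain]
    simp only [boxBasis_repr, mem_preimage, mem_univ_pi, mem_Ico, vadd_eq_add, PiLp.add_apply,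
      PiLp.neg_apply, a]
    refine forall_congr' fun i => ?_
    rw [inv_mul_lt_iff₀ (by positivity)]
    have : 0 ≤ (2 * L)⁻¹ * (- -L + v i) ↔ 0 ≤ - -L + v i :=
      mul_nonneg_iff_of_pos_left (by positivity)
    rw [this]
    constructor <;> rintro ⟨h1, h2⟩ <;> constructor <;> linarith
  have h2 : (a +ᵥ ZSpan.fundamentalDomain (boxBasis d hL) : Set (EuclideanSpace ℝ (Fin d)))
      =ᵐ[volume] velocityBox d L := by
    rw [h1, velocityBox_eq_preimage]
    exact (PiLp.volume_preserving_ofLp (Fin d)).quasiMeasurePreserving.preimage_ae_eq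
      Measure.univ_pi_Ico_ae_eq_Icc
  refine ⟨(measurableSet_velocityBox d L).nullMeasurableSet, ?_, ?_⟩
  · filter_upwards [h0.ae_covers, ae_all_iff.2 fun g : periodLattice d hL =>
      (measurePreserving_vadd g (volume : Measure (EuclideanSpace ℝ (Fin d)))
        ).quasiMeasurePreserving.ae h2.mem_iff] with x ⟨g, hg⟩ hx
    exact ⟨g, (hx g).1 hg⟩
  · intro g₁ g₂ hg
    refine (h0.aedisjoint hg).congr ?_ ?_
    · exact (vadd_set_ae_eq _).2 h2.symm
    · exact (vadd_set_ae_eq _).2 h2.symm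

theorem lintegral_velocityBox_add {d : ℕ} {L : ℝ} (hL : 0 < L)
    {F : EuclideanSpace ℝ (Fin d) → ℝ≥0∞} (hF : BoxPeriodic L F) (a : EuclideanSpace ℝ (Fin d)) :
    ∫⁻ v in velocityBox d L, F (v + a) = ∫⁻ v in velocityBox d L, F v := by
  have h := isAddFundamentalDomain_velocityBox d hL
  have h2 := (measurePreserving_add_right volume a).setLIntegral_comp_emb
    (measurableEmbedding_addRight a) F (velocityBox d L)
  have h3 : (fun v => v + a) '' velocityBox d L = a +ᵥ velocityBox d L := by
    simp only [← image_vadd, vadd_eq_add, add_comm]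
  rw [h2, h3]
  exact (h.vadd_of_comm a).setLIntegral_eq h F (hF.vadd hL)

theorem integral_velocityBox_add {d : ℕ} {L : ℝ} (hL : 0 < L)
    {F : EuclideanSpace ℝ (Fin d) → ℂ} (hF : BoxPeriodic L F) (a : EuclideanSpace ℝ (Fin d)) :
    ∫ v in velocityBox d L, F (v + a) = ∫ v in velocityBox d L, F v := by
  have h := isAddFundamentalDomain_velocityBox d hL
  have h2 := (measurePreserving_add_right volume a).setIntegral_image_emb
    (measurableEmbedding_addRight a) F (velocityBox d L)
  rw [← h2]
  have h3 : (fun v => v + a) '' velocityBox d L = a +ᵥ velocityBox d L := by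
    simp only [← image_vadd, vadd_eq_add, add_comm]
  rw [h3]
  exact (h.vadd_of_comm a).setIntegral_eq h (hF.vadd hL)

variable {d : ℕ} {L : ℝ}

theorem fourierMode_add_freq (p q : Fin d → ℤ) (v : EuclideanSpace ℝ (Fin d)) :
    fourierMode L (p + q) v = fourierMode L p v * fourierMode L q v := by
  simp only [fourierMode, ← Complex.exp_add, ← mul_add, ← Complex.ofReal_add, Pi.add_apply,
    Int.cast_add, add_mul, Finset.sum_add_distrib]

theorem fourierMode_add (p : Fin d → ℤ) (v w : EuclideanSpace ℝ (Fin d)) :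
    fourierMode L p (v + w) = fourierMode L p v * fourierMode L p w := by
  simp only [fourierMode, ← Complex.exp_add, PiLp.add_apply, mul_add, Finset.sum_add_distrib,
    Complex.ofReal_add]

theorem norm_fourierMode (p : Fin d → ℤ) (v : EuclideanSpace ℝ (Fin d)) :
    ‖fourierMode L p v‖ = 1 := by
  rw [fourierMode, mul_comm, Complex.norm_exp_ofReal_mul_I]

theorem conj_fourierMode (p : Fin d → ℤ) (v : EuclideanSpace ℝ (Fin d)) :
    (starRingEnd ℂ) (fourierMode L p v) = fourierMode L (-p) v := by
  simp only [fourierMode, ← Complex.exp_conj, map_mul, Complex.conj_I, Complex.conj_ofReal,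
    Pi.neg_apply, Int.cast_neg, neg_mul, Finset.sum_neg_distrib, mul_neg, Complex.ofReal_neg]

@[fun_prop]
theorem continuous_fourierMode (p : Fin d → ℤ) : Continuous (fourierMode L p) := by
  unfold fourierMode; fun_prop

theorem boxPeriodic_fourierMode (hL : 0 < L) (p : Fin d → ℤ) : BoxPeriodic L (fourierMode L p) := by
  intro v j
  rw [fourierMode_add]
  suffices fourierMode L p (EuclideanSpace.single j (2 * L)) = 1 by rw [this, mul_one]
  simp only [fourierMode, PiLp.single_apply, mul_ite, mul_zero, Finset.sum_ite_eq',
    Finset.mem_univ, if_true]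
  rw [Complex.exp_eq_one_iff]
  refine ⟨p j, ?_⟩
  push_cast
  have : (L : ℂ) ≠ 0 := by exact_mod_cast hL.ne'
  field_simp

theorem integral_fourierMode (hL : 0 < L) {p : Fin d → ℤ} (hp : p ≠ 0) :
    ∫ v in velocityBox d L, fourierMode L p v = 0 := by
  obtain ⟨j, hj⟩ := Function.ne_iff.1 hp
  have hj' : (p j : ℝ) ≠ 0 := by exact_mod_cast hj
  have h := integral_velocityBox_add hL (boxPeriodic_fourierMode hL p)
    (EuclideanSpace.single j (L / p j))
  -- the translation by half a wave length changes the sign of the mode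
  have h1 : fourierMode L p (EuclideanSpace.single j (L / p j)) = -1 := by
    simp only [fourierMode, PiLp.single_apply, mul_ite, mul_zero, Finset.sum_ite_eq',
      Finset.mem_univ, if_true]
    rw [← Complex.exp_pi_mul_I, mul_comm]
    congr 3
    field_simp
  simp only [fourierMode_add, h1, mul_neg, mul_one, integral_neg] at h
  exact self_eq_neg.1 h.symm

theorem integral_fourierMode_mul_conj (hL : 0 < L) (p q : Fin d → ℤ) :
    ∫ v in velocityBox d L, fourierMode L p v * (starRingEnd ℂ) (fourierMode L q v)
      = if p = q then (((2 * L) ^ d : ℝ) : ℂ) else 0 := by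
  simp only [conj_fourierMode, ← fourierMode_add_freq, ← sub_eq_add_neg]
  split_ifs with h
  · subst h
    simp [fourierMode, measureReal_def, volume_velocityBox d hL, ENNReal.toReal_ofReal, hL.le]
  · exact integral_fourierMode hL (sub_ne_zero.2 h)

/-- The trigonometric polynomial with the coefficients `x m`, `m ∈ Λ`. -/
def trigPoly (L : ℝ) (Λ : Finset (Fin d → ℤ)) (x : (Fin d → ℤ) → ℂ)
    (v : EuclideanSpace ℝ (Fin d)) : ℂ :=
  ∑ m ∈ Λ, x m * fourierMode L m v

@[fun_prop]
theorem continuous_trigPoly (Λ : Finset (Fin d → ℤ)) (x : (Fin d → ℤ) → ℂ) :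
    Continuous (trigPoly L Λ x) := by
  unfold trigPoly; fun_prop

theorem boxPeriodic_trigPoly (hL : 0 < L) (Λ : Finset (Fin d → ℤ)) (x : (Fin d → ℤ) → ℂ) :
    BoxPeriodic L (trigPoly L Λ x) := by
  intro v j
  simp only [trigPoly, boxPeriodic_fourierMode hL _ v j]

theorem integrableOn_velocityBox {f : EuclideanSpace ℝ (Fin d) → ℂ} (hf : Continuous f) :
    IntegrableOn f (velocityBox d L) :=
  hf.continuousOn.integrableOn_compact (isCompact_velocityBox d L)

/-- The `ℓ²` norm of the coefficients with frequencies in `Λ`. -/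
def coeffNorm (Λ : Finset (Fin d → ℤ)) (x : (Fin d → ℤ) → ℂ) : ℝ :=
  √(∑ m ∈ Λ, ‖x m‖ ^ 2)

theorem coeffNorm_nonneg (Λ : Finset (Fin d → ℤ)) (x : (Fin d → ℤ) → ℂ) : 0 ≤ coeffNorm Λ x :=
  Real.sqrt_nonneg _

theorem integral_trigPoly_mul_conj (hL : 0 < L) (Λ : Finset (Fin d → ℤ)) (x : (Fin d → ℤ) → ℂ)
    {m : Fin d → ℤ} (hm : m ∈ Λ) :
    ∫ v in velocityBox d L, trigPoly L Λ x v * (starRingEnd ℂ) (fourierMode L m v)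
      = (((2 * L) ^ d : ℝ) : ℂ) * x m := by
  simp only [trigPoly, Finset.sum_mul, mul_assoc]
  rw [integral_finsetSum _ fun p _ => ?_]
  · simp only [integral_const_mul, integral_fourierMode_mul_conj hL, mul_ite, mul_zero,
      Finset.sum_ite_eq', hm, if_true]
    ring
  · refine integrableOn_velocityBox ?_
    simp only [conj_fourierMode]
    fun_prop

/-- Parseval's identity. -/
theorem integral_norm_sq_trigPoly (hL : 0 < L) (Λ : Finset (Fin d → ℤ)) (x : (Fin d → ℤ) → ℂ) :
    ∫ v in velocityBox d L, ‖trigPoly L Λ x v‖ ^ 2 = (2 * L) ^ d * coeffNorm Λ x ^ 2 := by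
  have h : ∫ v in velocityBox d L, trigPoly L Λ x v * (starRingEnd ℂ) (trigPoly L Λ x v)
      = (((2 * L) ^ d * coeffNorm Λ x ^ 2 : ℝ) : ℂ) := by
    have : ∀ v, trigPoly L Λ x v * (starRingEnd ℂ) (trigPoly L Λ x v)
        = ∑ m ∈ Λ, (starRingEnd ℂ) (x m) *
          (trigPoly L Λ x v * (starRingEnd ℂ) (fourierMode L m v)) := fun v => by
      conv_lhs => arg 2; rw [trigPoly]
      rw [map_sum, Finset.mul_sum]
      exact Finset.sum_congr rfl fun m _ => by rw [map_mul]; ring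
    simp only [this]
    rw [integral_finsetSum _ fun p _ => ?_]
    · rw [coeffNorm, Real.sq_sqrt (by positivity), Finset.mul_sum, Complex.ofReal_sum]
      refine Finset.sum_congr rfl fun m hm => ?_
      rw [integral_const_mul, integral_trigPoly_mul_conj hL Λ x hm]
      rw [Complex.ofReal_mul, Complex.ofReal_pow ‖x m‖, ← Complex.conj_mul']
      ring
    · refine integrableOn_velocityBox ?_
      simp only [conj_fourierMode]
      fun_prop
  simp only [Complex.mul_conj'] at h
  have h2 : ∀ v, ((‖trigPoly L Λ x v‖ : ℂ)) ^ 2 = ((‖trigPoly L Λ x v‖ ^ 2 : ℝ) : ℂ) := fun v => by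
    push_cast; rfl
  simp only [h2, integral_complex_ofReal] at h
  exact_mod_cast h

theorem lintegral_enorm_sq_trigPoly (hL : 0 < L) (Λ : Finset (Fin d → ℤ)) (x : (Fin d → ℤ) → ℂ) :
    ∫⁻ v in velocityBox d L, ‖trigPoly L Λ x v‖ₑ ^ 2
      = ENNReal.ofReal ((2 * L) ^ d * coeffNorm Λ x ^ 2) := by
  rw [← integral_norm_sq_trigPoly hL, ofReal_integral_eq_lintegral_ofReal]
  · refine lintegral_congr fun v => ?_
    rw [ENNReal.ofReal_pow (norm_nonneg _), ofReal_norm]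
  · have hc : Continuous fun v => ‖trigPoly L Λ x v‖ ^ 2 := by fun_prop
    exact hc.continuousOn.integrableOn_compact (isCompact_velocityBox d L)
  · exact Filter.Eventually.of_forall fun v => by positivity

theorem normLp_two_trigPoly (hL : 0 < L) (Λ : Finset (Fin d → ℤ)) (x : (Fin d → ℤ) → ℂ) :
    normLp L 2 (trigPoly L Λ x) = ENNReal.ofReal (√((2 * L) ^ d) * coeffNorm Λ x) := by
  rw [normLp, eLpNorm_eq_lintegral_rpow_enorm_toReal (by simp) (by simp)]
  simp only [ENNReal.toReal_ofNat, ENNReal.rpow_ofNat]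
  rw [lintegral_enorm_sq_trigPoly hL, ENNReal.ofReal_rpow_of_nonneg (by positivity) (by positivity),
    ← Real.sqrt_eq_rpow, Real.sqrt_mul (by positivity), Real.sqrt_sq (coeffNorm_nonneg _ _)]

end

/-! ### Integration over relative velocities and scattering directions -/

section

/-- The surface measure on the unit sphere. -/
abbrev sphereMeasure (d : ℕ) : Measure (sphere (0 : EuclideanSpace ℝ (Fin d)) 1) :=
  (volume : Measure (EuclideanSpace ℝ (Fin d))).toSphere

/-- The measure `dξ dσ` on the pairs of a relative velocity `|ξ| ≤ R` and a direction `σ`. -/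
abbrev collisionMeasure (d : ℕ) (R : ℝ) :
    Measure (EuclideanSpace ℝ (Fin d) × sphere (0 : EuclideanSpace ℝ (Fin d)) 1) :=
  (volume.restrict (closedBall 0 R)).prod (sphereMeasure d)

variable {d : ℕ} {L R : ℝ}

/-- The pairs `(ξ, σ)` with `σ ⋅ ξ ≥ 0`; the symmetrized kernel vanishes outside of this set. -/
def forwardSet (d : ℕ) :
    Set (EuclideanSpace ℝ (Fin d) × sphere (0 : EuclideanSpace ℝ (Fin d)) 1) :=
  {ω | 0 ≤ inner ℝ (ω.2 : EuclideanSpace ℝ (Fin d)) ω.1}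

theorem measurableSet_forwardSet (d : ℕ) : MeasurableSet (forwardSet d) :=
  (isClosed_le continuous_const (by fun_prop)).measurableSet

theorem isFiniteMeasure_closedBall (d : ℕ) (R : ℝ) :
    IsFiniteMeasure (volume.restrict (closedBall (0 : EuclideanSpace ℝ (Fin d)) R)) :=
  ⟨by rw [Measure.restrict_apply_univ]; exact measure_closedBall_lt_top⟩

instance (d : ℕ) (R : ℝ) : IsFiniteMeasure (collisionMeasure d R) :=
  have := isFiniteMeasure_closedBall d R
  inferInstance

theorem closedBall_subset_velocityBox (hRL : R ≤ L) :
    closedBall (0 : EuclideanSpace ℝ (Fin d)) R ⊆ velocityBox d L := by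
  intro v hv i
  have h1 := (PiLp.norm_apply_le v i).trans ((mem_closedBall_zero_iff.1 hv).trans hRL)
  exact abs_le.1 h1

/-- Polar coordinates for the Lebesgue integral. -/
theorem lintegral_eq_lintegral_polar (hd : d ≠ 0) {F : EuclideanSpace ℝ (Fin d) → ℝ≥0∞}
    (hF : Measurable F) :
    ∫⁻ v, F v = ∫⁻ ρ : Ioi (0 : ℝ), ∫⁻ σ, F ((ρ : ℝ) • (σ : EuclideanSpace ℝ (Fin d)))
      ∂sphereMeasure d ∂Measure.volumeIoiPow
        (Module.finrank ℝ (EuclideanSpace ℝ (Fin d)) - 1) := by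
  have : NeZero d := ⟨hd⟩
  have hc : ∫⁻ v, F v = ∫⁻ v : ({0}ᶜ : Set (EuclideanSpace ℝ (Fin d))), F v
      ∂Measure.comap Subtype.val volume := by
    rw [lintegral_subtype_comap (measurableSet_singleton _).compl F,
      restrict_compl_singleton]
  have hmp := Measure.measurePreserving_homeomorphUnitSphereProd
    (volume : Measure (EuclideanSpace ℝ (Fin d)))
  rw [hc, ← hmp.symm (homeomorphUnitSphereProd _).toMeasurableEquiv |>.lintegral_comp_emb
    (MeasurableEquiv.measurableEmbedding _)]
  rw [lintegral_prod_symm]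
  · rfl
  · refine (hF.comp measurable_subtype_coe |>.comp ?_).aemeasurable
    exact MeasurableEquiv.measurable _

/-- Averaging over the direction of `ξ` independently of `ξ` itself. -/
theorem lintegral_norm_smul_sphere (hd : d ≠ 0) {F : EuclideanSpace ℝ (Fin d) → ℝ≥0∞}
    (hF : Measurable F) :
    ∫⁻ ω, F (‖ω.1‖ • (ω.2 : EuclideanSpace ℝ (Fin d))) ∂collisionMeasure d R
      = sphereMeasure d univ * ∫⁻ v in closedBall 0 R, F v := by
  have hB : MeasurableSet (closedBall (0 : EuclideanSpace ℝ (Fin d)) R) :=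
    measurableSet_closedBall
  have hm : Measurable fun ω : EuclideanSpace ℝ (Fin d) ×
      sphere (0 : EuclideanSpace ℝ (Fin d)) 1 => F (‖ω.1‖ • (ω.2 : EuclideanSpace ℝ (Fin d))) :=
    hF.comp (by fun_prop)
  rw [lintegral_prod _ hm.aemeasurable, ← lintegral_indicator hB, ← lintegral_indicator hB,
    lintegral_eq_lintegral_polar hd (hF.indicator hB),
    lintegral_eq_lintegral_polar hd (hm.lintegral_prod_right'.indicator hB),
    ← lintegral_const_mul']
  · refine lintegral_congr fun ρ => ?_
    have hρ : ∀ σ : sphere (0 : EuclideanSpace ℝ (Fin d)) 1,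
        ‖(ρ : ℝ) • (σ : EuclideanSpace ℝ (Fin d))‖ = ρ := fun σ => by
      rw [norm_smul, norm_eq_of_mem_sphere, mul_one, Real.norm_of_nonneg ρ.2.le]
    by_cases h : (ρ : ℝ) ≤ R
    · have hmem : ∀ σ : sphere (0 : EuclideanSpace ℝ (Fin d)) 1,
          (ρ : ℝ) • (σ : EuclideanSpace ℝ (Fin d)) ∈ closedBall 0 R := fun σ => by
        rw [mem_closedBall_zero_iff, hρ]; exact h
      simp only [indicator_of_mem (hmem _), hρ, lintegral_const, mul_comm]
    · have hmem : ∀ σ : sphere (0 : EuclideanSpace ℝ (Fin d)) 1,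
          (ρ : ℝ) • (σ : EuclideanSpace ℝ (Fin d)) ∉ closedBall 0 R := fun σ => by
        rw [mem_closedBall_zero_iff, hρ]; exact h
      simp only [indicator_of_notMem (hmem _), lintegral_zero, mul_zero]
  · exact measure_ne_top _ _

theorem hasFDerivAt_half_add_norm_smul {s ξ : EuclideanSpace ℝ (Fin d)} (hξ : ξ ≠ 0) :
    HasFDerivAt (fun x : EuclideanSpace ℝ (Fin d) => (1 / 2 : ℝ) • (x + ‖x‖ • s))
      ((1 / 2 : ℝ) • (ContinuousLinearMap.id ℝ (EuclideanSpace ℝ (Fin d)) +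
        ((‖ξ‖⁻¹ • innerSL ℝ ξ : EuclideanSpace ℝ (Fin d) →L[ℝ] ℝ)).smulRight s)) ξ := by
  have h1 : HasFDerivAt (fun x : EuclideanSpace ℝ (Fin d) => ‖x‖) (‖ξ‖⁻¹ • innerSL ℝ ξ) ξ := by
    have h2 := (hasStrictFDerivAt_norm_sq ξ).hasFDerivAt.sqrt
      (by simpa using hξ)
    simp only [Real.sqrt_sq (norm_nonneg _)] at h2
    refine h2.congr_fderiv ?_
    ext y
    simp
    field_simp
  exact ((hasFDerivAt_id ξ).add (h1.smul_const s)).const_smul (1 / 2 : ℝ)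

theorem det_half_id_add_smulRight (f : EuclideanSpace ℝ (Fin d) →L[ℝ] ℝ)
    (s : EuclideanSpace ℝ (Fin d)) :
    ((1 / 2 : ℝ) • (ContinuousLinearMap.id ℝ (EuclideanSpace ℝ (Fin d)) + f.smulRight s)).det
      = (1 / 2) ^ d * (1 + f s) := by
  have : ((1 / 2 : ℝ) • (ContinuousLinearMap.id ℝ (EuclideanSpace ℝ (Fin d)) +
      f.smulRight s) : EuclideanSpace ℝ (Fin d) →L[ℝ] EuclideanSpace ℝ (Fin d)).toLinearMap
      = (1 / 2 : ℝ) • LinearMap.transvection f.toLinearMap s := by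
    ext1 x
    simp [LinearMap.transvection.apply]
  rw [ContinuousLinearMap.det, this, LinearMap.det_smul, LinearMap.transvection.det]
  simp

theorem injOn_half_add_norm_smul {s : EuclideanSpace ℝ (Fin d)} (hs : ‖s‖ = 1) :
    InjOn (fun x : EuclideanSpace ℝ (Fin d) => (1 / 2 : ℝ) • (x + ‖x‖ • s))
      {ξ | ξ ≠ 0 ∧ 0 ≤ inner ℝ s ξ} := by
  intro ξ hξ η hη h
  have h1 : ξ + ‖ξ‖ • s = η + ‖η‖ • s := smul_right_injective _ (by norm_num : (1 / 2 : ℝ) ≠ 0) h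
  -- the length of `x` is recovered from `y = x + |x| s` as `|x| = |y|² / (2 s ⋅ y)`
  have h2 : ∀ x : EuclideanSpace ℝ (Fin d), ‖x + ‖x‖ • s‖ ^ 2 = 2 * ‖x‖ * inner ℝ s (x + ‖x‖ • s) :=
    fun x => by
      rw [norm_add_sq_real, inner_add_right, inner_smul_right, inner_smul_right,
        real_inner_self_eq_norm_sq, norm_smul, hs, real_inner_comm]
      simp; ring
  have h3 : 0 < inner ℝ s (ξ + ‖ξ‖ • s) := by
    rw [inner_add_right, inner_smul_right, real_inner_self_eq_norm_sq, hs]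
    have := norm_pos_iff.2 hξ.1
    have := hξ.2
    linarith
  have h4 : ‖ξ‖ = ‖η‖ := by
    have a := h2 ξ
    have b := h2 η
    rw [← h1] at b
    have : 2 * ‖ξ‖ * inner ℝ s (ξ + ‖ξ‖ • s) = 2 * ‖η‖ * inner ℝ s (ξ + ‖ξ‖ • s) := a.symm.trans b
    have := mul_right_cancel₀ h3.ne' this
    linarith
  rw [h4] at h1
  exact add_right_cancel h1

/-- The substitution `y = (ξ + |ξ| s) / 2` on the half space `s ⋅ ξ ≥ 0`, where its Jacobian
`2^{-d} (1 + s ⋅ ξ / |ξ|)` is at least `2^{-d}`. -/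
theorem lintegral_half_add_norm_smul_le (hd : d ≠ 0) {s : EuclideanSpace ℝ (Fin d)} (hs : ‖s‖ = 1)
    (F : EuclideanSpace ℝ (Fin d) → ℝ≥0∞) :
    ∫⁻ ξ in closedBall 0 R ∩ {ξ | 0 ≤ inner ℝ s ξ}, F ((1 / 2 : ℝ) • (ξ + ‖ξ‖ • s))
      ≤ 2 ^ d * ∫⁻ y in closedBall 0 R, F y := by
  have : NeZero d := ⟨hd⟩
  set T : EuclideanSpace ℝ (Fin d) → EuclideanSpace ℝ (Fin d) :=
    fun x => (1 / 2 : ℝ) • (x + ‖x‖ • s) with hT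
  set A : Set (EuclideanSpace ℝ (Fin d)) := closedBall 0 R ∩ {ξ | 0 ≤ inner ℝ s ξ} with hA
  have hAm : MeasurableSet A := measurableSet_closedBall.inter
    (isClosed_le continuous_const (by fun_prop)).measurableSet
  have h0 : ∫⁻ ξ in A, F (T ξ) = ∫⁻ ξ in A \ {0}, F (T ξ) := by
    refine (setLIntegral_congr ?_).symm
    exact sdiff_null_ae_eq_self (measure_singleton _)
  rw [h0]
  have h1 := lintegral_image_eq_lintegral_abs_det_fderiv_mul volume
    (hAm.diff (measurableSet_singleton 0))
    (fun ξ hξ => (hasFDerivAt_half_add_norm_smul (s := s) hξ.2).hasFDerivWithinAt)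
    ((injOn_half_add_norm_smul hs).mono
      (show A \ {0} ⊆ {ξ | ξ ≠ 0 ∧ 0 ≤ inner ℝ s ξ} from fun ξ hξ => ⟨hξ.2, hξ.1.2⟩)) F
  have h2 : T '' (A \ {0}) ⊆ closedBall 0 R := by
    rintro _ ⟨ξ, hξ, rfl⟩
    rw [mem_closedBall_zero_iff]
    have h3 := mem_closedBall_zero_iff.1 hξ.1.1
    have h4 : ‖ξ + ‖ξ‖ • s‖ ≤ ‖ξ‖ + ‖ξ‖ := (norm_add_le _ _).trans (by rw [norm_smul, hs]; simp)
    rw [hT]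
    simp only [norm_smul]
    norm_num
    linarith
  have hinv : (2 : ℝ≥0∞) ^ d * ENNReal.ofReal ((1 / 2) ^ d) = 1 := by
    rw [ENNReal.ofReal_pow (by norm_num), ← mul_pow]
    rw [one_div, ENNReal.ofReal_inv_of_pos (by norm_num)]
    simp [ENNReal.mul_inv_cancel]
  calc ∫⁻ ξ in A \ {0}, F (T ξ)
      = 2 ^ d * ∫⁻ ξ in A \ {0}, ENNReal.ofReal ((1 / 2) ^ d) * F (T ξ) := by
        rw [lintegral_const_mul' _ _ ENNReal.ofReal_ne_top, ← mul_assoc, hinv, one_mul]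
    _ ≤ 2 ^ d * ∫⁻ y in T '' (A \ {0}), F y := by
        rw [h1]
        gcongr 2 ^ d * ?_
        refine setLIntegral_mono' (hAm.diff (measurableSet_singleton 0)) fun ξ hξ => ?_
        gcongr ENNReal.ofReal ?_ * _
        rw [det_half_id_add_smulRight]
        refine le_trans ?_ (le_abs_self _)
        refine le_mul_of_one_le_right (by positivity) ?_
        have : 0 ≤ inner ℝ s ξ := hξ.1.2
        have h5 : 0 ≤ (‖ξ‖⁻¹ • innerSL ℝ ξ) s := by
          simp only [smul_apply, innerSL_apply_apply, smul_eq_mul]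
          rw [real_inner_comm]
          positivity
        linarith
    _ ≤ 2 ^ d * ∫⁻ y in closedBall 0 R, F y := by
        gcongr

theorem lintegral_closedBall_add_le (hL : 0 < L) (hRL : R ≤ L)
    {F : EuclideanSpace ℝ (Fin d) → ℝ≥0∞} (hF : BoxPeriodic L F)
    (u : EuclideanSpace ℝ (Fin d)) :
    ∫⁻ y in closedBall 0 R, F (u + y) ≤ ∫⁻ v in velocityBox d L, F v := by
  rw [← lintegral_velocityBox_add hL hF u]
  simp only [add_comm u]
  exact lintegral_mono_set (closedBall_subset_velocityBox hRL)

theorem lintegral_closedBall_sub_le (hL : 0 < L) (hRL : R ≤ L)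
    {F : EuclideanSpace ℝ (Fin d) → ℝ≥0∞} (hF : BoxPeriodic L F)
    (u : EuclideanSpace ℝ (Fin d)) :
    ∫⁻ y in closedBall 0 R, F (u - y) ≤ ∫⁻ v in velocityBox d L, F v := by
  refine le_of_eq_of_le ?_ (lintegral_closedBall_add_le hL hRL hF u)
  have := (Measure.measurePreserving_neg (volume : Measure (EuclideanSpace ℝ (Fin d))))
    |>.setLIntegral_comp_preimage_emb (MeasurableEquiv.neg _).measurableEmbedding
    (fun y => F (u + y)) (closedBall 0 R)
  rw [← this]
  simp [sub_eq_add_neg]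

/-- Cauchy–Schwarz for the Lebesgue integral, in terms of square roots. -/
theorem lintegral_mul_le_sqrt {α : Type*} [MeasurableSpace α] (μ : Measure α) {f g : α → ℝ≥0∞}
    (hf : AEMeasurable f μ) (hg : AEMeasurable g μ) :
    ∫⁻ a, f a * g a ∂μ
      ≤ (∫⁻ a, f a ^ 2 ∂μ) ^ (1 / 2 : ℝ) * (∫⁻ a, g a ^ 2 ∂μ) ^ (1 / 2 : ℝ) := by
  have := ENNReal.lintegral_mul_le_Lp_mul_Lq μ Real.HolderConjugate.two_two hf hg
  simpa using this

/-- The gain term: for a fixed pre-collisional velocity `u = v'_*` the pairing of `f(v')` and `h(v)`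
is controlled by Cauchy–Schwarz over `(ξ, σ)`, as `v' = u + |ξ| σ` and `v = u + (ξ + |ξ| σ) / 2`
are both non-degenerate in the variable `ξ`. -/
theorem lintegral_gain_le (hd : d ≠ 0) (hL : 0 < L) (hRL : R ≤ L)
    {g f h : EuclideanSpace ℝ (Fin d) → ℝ≥0∞} (hg : Measurable g) (hf : Measurable f)
    (hh : Measurable h) (pg : BoxPeriodic L g) (pf : BoxPeriodic L f) (ph : BoxPeriodic L h) :
    ∫⁻ v in velocityBox d L, ∫⁻ ω, (forwardSet d).indicator (fun ω =>
          g (v - (1 / 2 : ℝ) • (ω.1 + ‖ω.1‖ • (ω.2 : EuclideanSpace ℝ (Fin d))))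
            * f (v - (1 / 2 : ℝ) • (ω.1 - ‖ω.1‖ • (ω.2 : EuclideanSpace ℝ (Fin d)))) * h v) ω
        ∂collisionMeasure d R
      ≤ 2 ^ d * sphereMeasure d univ * (∫⁻ v in velocityBox d L, g v) *
        ((∫⁻ v in velocityBox d L, f v ^ 2) ^ (1 / 2 : ℝ) *
          (∫⁻ v in velocityBox d L, h v ^ 2) ^ (1 / 2 : ℝ)) := by
  have := isFiniteMeasure_velocityBox d hL
  have := isFiniteMeasure_closedBall d R
  have hPm := measurableSet_forwardSet d
  set P := forwardSet d with hP
  set y : EuclideanSpace ℝ (Fin d) × sphere (0 : EuclideanSpace ℝ (Fin d)) 1 →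
    EuclideanSpace ℝ (Fin d) :=
      fun ω => (1 / 2 : ℝ) • (ω.1 + ‖ω.1‖ • (ω.2 : EuclideanSpace ℝ (Fin d))) with hy
  have hym : Measurable y := by fun_prop
  rw [lintegral_lintegral_swap]
  swap
  · have hP' : MeasurableSet {z : EuclideanSpace ℝ (Fin d) × EuclideanSpace ℝ (Fin d) ×
        sphere (0 : EuclideanSpace ℝ (Fin d)) 1 | z.2 ∈ P} := measurable_snd hPm
    refine Measurable.aemeasurable ?_
    refine Measurable.indicator (f := fun z : EuclideanSpace ℝ (Fin d) × EuclideanSpace ℝ (Fin d) ×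
        sphere (0 : EuclideanSpace ℝ (Fin d)) 1 => _) ?_ hP'
    refine ((hg.comp ?_).mul (hf.comp ?_)).mul (hh.comp measurable_fst) <;> fun_prop
  -- translation by `y ω` in the velocity
  have h1 : ∀ ω, ∫⁻ v in velocityBox d L, P.indicator (fun ω => g (v - y ω)
        * f (v - (1 / 2 : ℝ) • (ω.1 - ‖ω.1‖ • (ω.2 : EuclideanSpace ℝ (Fin d)))) * h v) ω
      = ∫⁻ u in velocityBox d L, g u * P.indicator (fun ω =>
        f (u + ‖ω.1‖ • (ω.2 : EuclideanSpace ℝ (Fin d))) * h (u + y ω)) ω := by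
    intro ω
    by_cases hω : ω ∈ P
    · simp only [indicator_of_mem hω]
      have hp : BoxPeriodic L fun v => g (v - y ω)
        * f (v - (1 / 2 : ℝ) • (ω.1 - ‖ω.1‖ • (ω.2 : EuclideanSpace ℝ (Fin d)))) * h v := by
        intro v j
        have e1 := pg.comp_add (-(y ω)) v j
        have e2 := pf.comp_add
          (-((1 / 2 : ℝ) • (ω.1 - ‖ω.1‖ • (ω.2 : EuclideanSpace ℝ (Fin d))))) v j
        simp only [← sub_eq_add_neg] at e1 e2
        simp only [e1, e2, ph v j]
      rw [← lintegral_velocityBox_add hL hp (y ω)]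
      refine lintegral_congr fun u => ?_
      rw [add_sub_cancel_right, mul_assoc]
      congr 3
      simp only [hy]
      module
    · simp [indicator_of_notMem hω]
  simp only [hy] at h1 ⊢
  simp only [h1]
  rw [lintegral_lintegral_swap]
  swap
  · have hP' : MeasurableSet {z : (EuclideanSpace ℝ (Fin d) ×
        sphere (0 : EuclideanSpace ℝ (Fin d)) 1) × EuclideanSpace ℝ (Fin d) | z.1 ∈ P} :=
      measurable_fst hPm
    refine Measurable.aemeasurable ?_
    refine (hg.comp measurable_snd).mul ?_
    refine Measurable.indicator (f := fun z : (EuclideanSpace ℝ (Fin d) ×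
        sphere (0 : EuclideanSpace ℝ (Fin d)) 1) × EuclideanSpace ℝ (Fin d) => _) ?_ hP'
    refine (hf.comp ?_).mul (hh.comp ?_) <;> fun_prop
  set CF := ∫⁻ v in velocityBox d L, f v ^ 2 with hCF
  set CH := ∫⁻ v in velocityBox d L, h v ^ 2 with hCH
  set τ := sphereMeasure d univ with hτ
  have h2 : ∀ u, ∫⁻ ω, P.indicator (fun ω =>
        f (u + ‖ω.1‖ • (ω.2 : EuclideanSpace ℝ (Fin d))) * h (u + y ω)) ω ∂collisionMeasure d R
      ≤ 2 ^ d * τ * (CF ^ (1 / 2 : ℝ) * CH ^ (1 / 2 : ℝ)) := by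
    intro u
    have hfm : Measurable fun ω : EuclideanSpace ℝ (Fin d) ×
        sphere (0 : EuclideanSpace ℝ (Fin d)) 1 =>
        f (u + ‖ω.1‖ • (ω.2 : EuclideanSpace ℝ (Fin d))) := hf.comp (by fun_prop)
    have hhm : Measurable (P.indicator fun ω => h (u + y ω)) :=
      (hh.comp (by fun_prop)).indicator hPm
    have e1 : ∀ ω, P.indicator (fun ω =>
        f (u + ‖ω.1‖ • (ω.2 : EuclideanSpace ℝ (Fin d))) * h (u + y ω)) ω
        = f (u + ‖ω.1‖ • (ω.2 : EuclideanSpace ℝ (Fin d))) *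
          P.indicator (fun ω => h (u + y ω)) ω := fun ω => by
      by_cases hω : ω ∈ P <;> simp [hω]
    simp only [e1]
    refine (lintegral_mul_le_sqrt _ hfm.aemeasurable hhm.aemeasurable).trans ?_
    have e2 : ∫⁻ ω, f (u + ‖ω.1‖ • (ω.2 : EuclideanSpace ℝ (Fin d))) ^ 2 ∂collisionMeasure d R
        ≤ 2 ^ d * τ * CF := by
      rw [lintegral_norm_smul_sphere hd (F := fun y => f (u + y) ^ 2) (by fun_prop)]
      gcongr
      · exact le_mul_of_one_le_left zero_le (one_le_pow₀ (by norm_num))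
      · exact lintegral_closedBall_add_le hL hRL (pf.comp (· ^ 2)) u
    have e3 : ∫⁻ ω, P.indicator (fun ω => h (u + y ω)) ω ^ 2 ∂collisionMeasure d R
        ≤ 2 ^ d * τ * CH := by
      rw [lintegral_prod_symm _ (hhm.pow_const 2).aemeasurable]
      calc _ ≤ ∫⁻ σ, 2 ^ d * CH ∂sphereMeasure d := by
            refine lintegral_mono fun σ => ?_
            have hHm : MeasurableSet {ξ : EuclideanSpace ℝ (Fin d) |
                0 ≤ inner ℝ (σ : EuclideanSpace ℝ (Fin d)) ξ} :=
              (isClosed_le continuous_const (by fun_prop)).measurableSet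
            have e4 : ∀ ξ, P.indicator (fun ω => h (u + y ω)) (ξ, σ) ^ 2
                = {ξ : EuclideanSpace ℝ (Fin d) |
                    0 ≤ inner ℝ (σ : EuclideanSpace ℝ (Fin d)) ξ}.indicator
                  (fun ξ =>
                    h (u + (1 / 2 : ℝ) • (ξ + ‖ξ‖ • (σ : EuclideanSpace ℝ (Fin d)))) ^ 2) ξ :=
              fun ξ => by
                by_cases hξ : 0 ≤ inner ℝ (σ : EuclideanSpace ℝ (Fin d)) ξ <;>
                  simp [indicator, hP, forwardSet, hy, hξ]
            simp only [e4]
            rw [lintegral_indicator hHm, Measure.restrict_restrict hHm, inter_comm]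
            refine (lintegral_half_add_norm_smul_le hd (norm_eq_of_mem_sphere σ)
              (fun y => h (u + y) ^ 2)).trans ?_
            gcongr
            exact lintegral_closedBall_add_le hL hRL (ph.comp (· ^ 2)) u
        _ = 2 ^ d * τ * CH := by rw [lintegral_const]; ring
    calc _ ≤ (2 ^ d * τ * CF) ^ (1 / 2 : ℝ) * (2 ^ d * τ * CH) ^ (1 / 2 : ℝ) := by gcongr
      _ = 2 ^ d * τ * (CF ^ (1 / 2 : ℝ) * CH ^ (1 / 2 : ℝ)) := by
        rw [ENNReal.mul_rpow_of_nonneg _ _ (by norm_num),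
          ENNReal.mul_rpow_of_nonneg _ CH (by norm_num), mul_mul_mul_comm,
          ← ENNReal.rpow_add_of_nonneg _ _ (by norm_num) (by norm_num)]
        norm_num
  calc _ ≤ ∫⁻ u in velocityBox d L, g u * (2 ^ d * τ * (CF ^ (1 / 2 : ℝ) * CH ^ (1 / 2 : ℝ))) := by
        refine lintegral_mono fun u => ?_
        rw [lintegral_const_mul _ ?_]
        · exact mul_le_mul_right (h2 u) (g u)
        · exact Measurable.indicator ((hf.comp (by fun_prop)).mul (hh.comp (by fun_prop))) hPm
    _ = _ := by
        rw [lintegral_mul_const _ hg]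
        ring

theorem lintegral_loss_le (hL : 0 < L) (hRL : R ≤ L)
    {g f h : EuclideanSpace ℝ (Fin d) → ℝ≥0∞} (hg : Measurable g) (hf : Measurable f)
    (hh : Measurable h) (pg : BoxPeriodic L g) :
    ∫⁻ v in velocityBox d L, ∫⁻ ω, g (v - ω.1) * f v * h v ∂collisionMeasure d R
      ≤ sphereMeasure d univ * (∫⁻ v in velocityBox d L, g v) *
        ((∫⁻ v in velocityBox d L, f v ^ 2) ^ (1 / 2 : ℝ) *
          (∫⁻ v in velocityBox d L, h v ^ 2) ^ (1 / 2 : ℝ)) := by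
  have h1 : ∀ v, ∫⁻ ω, g (v - ω.1) * f v * h v ∂collisionMeasure d R
      ≤ sphereMeasure d univ * (∫⁻ v in velocityBox d L, g v) * (f v * h v) := by
    intro v
    have hm : Measurable fun ω : EuclideanSpace ℝ (Fin d) ×
      sphere (0 : EuclideanSpace ℝ (Fin d)) 1 => g (v - ω.1) := hg.comp (by fun_prop)
    simp only [mul_assoc (g _)]
    rw [lintegral_mul_const _ hm, lintegral_prod _ hm.aemeasurable]
    simp only [lintegral_const]
    rw [lintegral_mul_const' _ _ (measure_ne_top _ _), mul_comm (lintegral _ _)]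
    gcongr sphereMeasure d univ * ?_ * _
    exact lintegral_closedBall_sub_le hL hRL pg v
  calc _ ≤ ∫⁻ v in velocityBox d L,
        sphereMeasure d univ * (∫⁻ v in velocityBox d L, g v) * (f v * h v) := lintegral_mono h1
    _ ≤ _ := by
      rw [lintegral_const_mul (f := fun v => f v * h v) _ (hf.mul hh)]
      gcongr
      exact lintegral_mul_le_sqrt _ hf.aemeasurable hh.aemeasurable

end

/-! ### The collision operator on trigonometric polynomials -/

section

variable {d : ℕ} {L R : ℝ}

/-- The multiplier with which a pair `(ξ, σ)` acts on the product of the modes `p` and `q`: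
`Φ_p(v'_*) Φ_q(v') - Φ_p(v - ξ) Φ_q(v)` is this multiplier times `Φ_{p+q}(v)`. -/
def collisionPhase (L : ℝ) (p q : Fin d → ℤ)
    (ω : EuclideanSpace ℝ (Fin d) × sphere (0 : EuclideanSpace ℝ (Fin d)) 1) : ℂ :=
  fourierMode L p (-((1 / 2 : ℝ) • (ω.1 + ‖ω.1‖ • (ω.2 : EuclideanSpace ℝ (Fin d))))) *
      fourierMode L q (-((1 / 2 : ℝ) • (ω.1 - ‖ω.1‖ • (ω.2 : EuclideanSpace ℝ (Fin d))))) -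
    fourierMode L p (-ω.1)

/-- The matrix entry `β(p, q)` of the collision operator with the kernel `k` in the modes. -/
def galerkinCoeff (L R : ℝ)
    (k : EuclideanSpace ℝ (Fin d) × sphere (0 : EuclideanSpace ℝ (Fin d)) 1 → ℂ)
    (p q : Fin d → ℤ) : ℂ :=
  ∫ ω, k ω * collisionPhase L p q ω ∂collisionMeasure d R

/-- The bilinear form `∑_{p+q=m} β(p, q) x_p y_q` on the coefficients. -/
def galerkinForm (Λ : Finset (Fin d → ℤ)) (β : (Fin d → ℤ) → (Fin d → ℤ) → ℂ)
    (x y : (Fin d → ℤ) → ℂ) (m : Fin d → ℤ) : ℂ :=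
  ∑ p ∈ Λ, ∑ q ∈ Λ, if p + q = m then β p q * (x p * y q) else 0

@[fun_prop]
theorem continuous_collisionPhase (p q : Fin d → ℤ) : Continuous (collisionPhase L p q) := by
  unfold collisionPhase; fun_prop

theorem norm_collisionPhase_le (p q : Fin d → ℤ)
    (ω : EuclideanSpace ℝ (Fin d) × sphere (0 : EuclideanSpace ℝ (Fin d)) 1) :
    ‖collisionPhase L p q ω‖ ≤ 2 := by
  refine (norm_sub_le _ _).trans ?_
  rw [norm_mul, norm_fourierMode, norm_fourierMode, norm_fourierMode]
  norm_num

theorem integrable_mul_collisionPhase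
    {k : EuclideanSpace ℝ (Fin d) × sphere (0 : EuclideanSpace ℝ (Fin d)) 1 → ℂ}
    (hk : Integrable k (collisionMeasure d R)) (p q : Fin d → ℤ) :
    Integrable (fun ω => k ω * collisionPhase L p q ω) (collisionMeasure d R) :=
  hk.mul_bdd (c := 2) (continuous_collisionPhase p q).aestronglyMeasurable
    (Filter.Eventually.of_forall (norm_collisionPhase_le p q))

theorem collisionIntegrand_trigPoly (Λ : Finset (Fin d → ℤ)) (x y : (Fin d → ℤ) → ℂ)
    (a : ℂ) (v : EuclideanSpace ℝ (Fin d))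
    (ω : EuclideanSpace ℝ (Fin d) × sphere (0 : EuclideanSpace ℝ (Fin d)) 1) :
    a * (trigPoly L Λ x (v - (1 / 2 : ℝ) • (ω.1 + ‖ω.1‖ • (ω.2 : EuclideanSpace ℝ (Fin d)))) *
        trigPoly L Λ y (v - (1 / 2 : ℝ) • (ω.1 - ‖ω.1‖ • (ω.2 : EuclideanSpace ℝ (Fin d)))) -
        trigPoly L Λ x (v - ω.1) * trigPoly L Λ y v)
      = ∑ p ∈ Λ, ∑ q ∈ Λ, x p * y q * fourierMode L (p + q) v *
          (a * collisionPhase L p q ω) := by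
  simp only [trigPoly]
  simp only [Finset.sum_mul_sum]
  simp only [← Finset.sum_sub_distrib]
  rw [Finset.mul_sum]
  simp only [Finset.mul_sum, collisionPhase, sub_eq_add_neg v]
  simp only [fourierMode_add, fourierMode_add_freq]
  refine Finset.sum_congr rfl fun p _ => Finset.sum_congr rfl fun q _ => ?_
  ring

theorem integrable_collisionIntegrand_trigPoly
    {k : EuclideanSpace ℝ (Fin d) × sphere (0 : EuclideanSpace ℝ (Fin d)) 1 → ℂ}
    (hk : Integrable k (collisionMeasure d R)) (Λ : Finset (Fin d → ℤ)) (x y : (Fin d → ℤ) → ℂ)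
    (v : EuclideanSpace ℝ (Fin d)) :
    Integrable (fun ω => k ω *
      (trigPoly L Λ x (v - (1 / 2 : ℝ) • (ω.1 + ‖ω.1‖ • (ω.2 : EuclideanSpace ℝ (Fin d)))) *
        trigPoly L Λ y (v - (1 / 2 : ℝ) • (ω.1 - ‖ω.1‖ • (ω.2 : EuclideanSpace ℝ (Fin d)))) -
        trigPoly L Λ x (v - ω.1) * trigPoly L Λ y v)) (collisionMeasure d R) := by
  simp only [collisionIntegrand_trigPoly]
  exact integrable_finsetSum _ fun p _ => integrable_finsetSum _ fun q _ =>
    (integrable_mul_collisionPhase hk p q).const_mul _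

theorem integral_collisionIntegrand_trigPoly
    {k : EuclideanSpace ℝ (Fin d) × sphere (0 : EuclideanSpace ℝ (Fin d)) 1 → ℂ}
    (hk : Integrable k (collisionMeasure d R)) (Λ : Finset (Fin d → ℤ)) (x y : (Fin d → ℤ) → ℂ)
    (v : EuclideanSpace ℝ (Fin d)) :
    ∫ ω, k ω * (trigPoly L Λ x (v - (1 / 2 : ℝ) •
        (ω.1 + ‖ω.1‖ • (ω.2 : EuclideanSpace ℝ (Fin d)))) *
        trigPoly L Λ y (v - (1 / 2 : ℝ) • (ω.1 - ‖ω.1‖ • (ω.2 : EuclideanSpace ℝ (Fin d)))) -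
        trigPoly L Λ x (v - ω.1) * trigPoly L Λ y v) ∂collisionMeasure d R
      = ∑ p ∈ Λ, ∑ q ∈ Λ, galerkinCoeff L R k p q * (x p * y q) * fourierMode L (p + q) v := by
  simp only [collisionIntegrand_trigPoly]
  rw [integral_finsetSum _ fun p _ => integrable_finsetSum _ fun q _ =>
    (integrable_mul_collisionPhase hk p q).const_mul _]
  refine Finset.sum_congr rfl fun p _ => ?_
  rw [integral_finsetSum _ fun q _ => (integrable_mul_collisionPhase hk p q).const_mul _]
  refine Finset.sum_congr rfl fun q _ => ?_
  rw [integral_const_mul, galerkinCoeff]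
  ring

theorem integral_sum_fourierMode_mul_conj (hL : 0 < L) (Λ : Finset (Fin d → ℤ))
    (a : (Fin d → ℤ) → (Fin d → ℤ) → ℂ) (m : Fin d → ℤ) :
    ∫ v in velocityBox d L, (∑ p ∈ Λ, ∑ q ∈ Λ, a p q * fourierMode L (p + q) v) *
        (starRingEnd ℂ) (fourierMode L m v)
      = (((2 * L) ^ d : ℝ) : ℂ) * ∑ p ∈ Λ, ∑ q ∈ Λ, if p + q = m then a p q else 0 := by
  have hc : ∀ p q, Continuous fun v => a p q *
      (fourierMode L (p + q) v * (starRingEnd ℂ) (fourierMode L m v)) := fun p q => by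
    simp only [conj_fourierMode]
    fun_prop
  simp only [Finset.sum_mul, mul_assoc]
  rw [integral_finsetSum _ fun p _ => integrable_finsetSum _ fun q _ =>
    integrableOn_velocityBox (hc p q), Finset.mul_sum]
  refine Finset.sum_congr rfl fun p _ => ?_
  rw [integral_finsetSum _ fun q _ => integrableOn_velocityBox (hc p q), Finset.mul_sum]
  refine Finset.sum_congr rfl fun q _ => ?_
  rw [integral_const_mul, integral_fourierMode_mul_conj hL]
  split_ifs <;> ring

/-- The constant of the bilinear `L¹ × L² → L²` estimate. -/
def bilinearConst (d : ℕ) : ℝ := 2 * (2 ^ d * (sphereMeasure d univ).toReal)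

theorem bilinearConst_nonneg (d : ℕ) : 0 ≤ bilinearConst d := by
  unfold bilinearConst; positivity

/-- The collision operator with a kernel that is bounded by `A` and supported in the forward
directions, tested against `h`. -/
theorem lintegral_collision_mul_le (hd : d ≠ 0) (hL : 0 < L) (hRL : R ≤ L) {A : ℝ} (hA : 0 ≤ A)
    {k : EuclideanSpace ℝ (Fin d) × sphere (0 : EuclideanSpace ℝ (Fin d)) 1 → ℂ}
    (hkA : ∀ᵐ ω ∂collisionMeasure d R, ‖k ω‖ ≤ A ∧ (ω ∉ forwardSet d → k ω = 0))
    {g f h : EuclideanSpace ℝ (Fin d) → ℂ} (hg : Continuous g) (hf : Continuous f)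
    (hh : Continuous h) (pg : BoxPeriodic L g) (pf : BoxPeriodic L f) (ph : BoxPeriodic L h) :
    ∫⁻ v in velocityBox d L, ‖∫ ω, k ω *
        (g (v - (1 / 2 : ℝ) • (ω.1 + ‖ω.1‖ • (ω.2 : EuclideanSpace ℝ (Fin d)))) *
        f (v - (1 / 2 : ℝ) • (ω.1 - ‖ω.1‖ • (ω.2 : EuclideanSpace ℝ (Fin d)))) -
        g (v - ω.1) * f v) ∂collisionMeasure d R‖ₑ * ‖h v‖ₑ
      ≤ ENNReal.ofReal (A * bilinearConst d) * (∫⁻ v in velocityBox d L, ‖g v‖ₑ) *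
        ((∫⁻ v in velocityBox d L, ‖f v‖ₑ ^ 2) ^ (1 / 2 : ℝ) *
          (∫⁻ v in velocityBox d L, ‖h v‖ₑ ^ 2) ^ (1 / 2 : ℝ)) := by
  set τ := sphereMeasure d univ with hτ
  set N := (∫⁻ v in velocityBox d L, ‖g v‖ₑ) *
        ((∫⁻ v in velocityBox d L, ‖f v‖ₑ ^ 2) ^ (1 / 2 : ℝ) *
          (∫⁻ v in velocityBox d L, ‖h v‖ₑ ^ 2) ^ (1 / 2 : ℝ)) with hN
  set G : EuclideanSpace ℝ (Fin d) → EuclideanSpace ℝ (Fin d) ×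
      sphere (0 : EuclideanSpace ℝ (Fin d)) 1 → ℝ≥0∞ := fun v => (forwardSet d).indicator fun ω =>
    ‖g (v - (1 / 2 : ℝ) • (ω.1 + ‖ω.1‖ • (ω.2 : EuclideanSpace ℝ (Fin d))))‖ₑ *
      ‖f (v - (1 / 2 : ℝ) • (ω.1 - ‖ω.1‖ • (ω.2 : EuclideanSpace ℝ (Fin d))))‖ₑ * ‖h v‖ₑ with hG
  set B : EuclideanSpace ℝ (Fin d) → EuclideanSpace ℝ (Fin d) ×
      sphere (0 : EuclideanSpace ℝ (Fin d)) 1 → ℝ≥0∞ := fun v ω =>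
    ‖g (v - ω.1)‖ₑ * ‖f v‖ₑ * ‖h v‖ₑ with hB
  have hPm := measurableSet_forwardSet d
  have hBm : Measurable (Function.uncurry B) := by
    simp only [hB, Function.uncurry_def]
    exact ((hg.measurable.enorm.comp (by fun_prop)).mul
      (hf.measurable.enorm.comp (by fun_prop))).mul (hh.measurable.enorm.comp (by fun_prop))
  have hgain : ∫⁻ v in velocityBox d L, ∫⁻ ω, G v ω ∂collisionMeasure d R ≤ 2 ^ d * τ * N := by
    rw [hN, ← mul_assoc]
    exact lintegral_gain_le hd hL hRL (by fun_prop) (by fun_prop) (by fun_prop)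
      (pg.comp (‖·‖ₑ)) (pf.comp (‖·‖ₑ)) (ph.comp (‖·‖ₑ))
  have hloss : ∫⁻ v in velocityBox d L, ∫⁻ ω, B v ω ∂collisionMeasure d R ≤ 2 ^ d * τ * N := by
    calc _ ≤ τ * N := by
          rw [hN, ← mul_assoc]
          exact lintegral_loss_le hL hRL (by fun_prop) (by fun_prop) (by fun_prop)
            (pg.comp (‖·‖ₑ))
      _ ≤ 2 ^ d * τ * N := by
          gcongr
          exact le_mul_of_one_le_left zero_le (one_le_pow₀ (by norm_num))
  have hpt : ∀ v, ‖∫ ω, k ω *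
        (g (v - (1 / 2 : ℝ) • (ω.1 + ‖ω.1‖ • (ω.2 : EuclideanSpace ℝ (Fin d)))) *
        f (v - (1 / 2 : ℝ) • (ω.1 - ‖ω.1‖ • (ω.2 : EuclideanSpace ℝ (Fin d)))) -
        g (v - ω.1) * f v) ∂collisionMeasure d R‖ₑ * ‖h v‖ₑ
      ≤ ENNReal.ofReal A * ((∫⁻ ω, G v ω ∂collisionMeasure d R) +
          ∫⁻ ω, B v ω ∂collisionMeasure d R) := by
    intro v
    rw [← lintegral_add_right _ (hBm.of_uncurry_left), ← lintegral_const_mul' _ _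
      ENNReal.ofReal_ne_top]
    refine (mul_le_mul_left (enorm_integral_le_lintegral_enorm _) _).trans ?_
    rw [← lintegral_mul_const' _ _ enorm_ne_top]
    refine lintegral_mono_ae ?_
    filter_upwards [hkA] with ω hω
    by_cases hmem : ω ∈ forwardSet d
    · simp only [hG, hB, indicator_of_mem hmem]
      rw [enorm_mul, ← add_mul, ← mul_assoc]
      gcongr
      · rw [← ofReal_norm]
        exact ENNReal.ofReal_le_ofReal hω.1
      · refine (enorm_sub_le).trans ?_
        simp only [enorm_mul, le_refl]
    · simp [hω.2 hmem]
  have hGm : AEMeasurable (fun v => ∫⁻ ω, B v ω ∂collisionMeasure d R)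
      (volume.restrict (velocityBox d L)) := hBm.lintegral_prod_right'.aemeasurable
  calc _ ≤ ∫⁻ v in velocityBox d L, ENNReal.ofReal A * ((∫⁻ ω, G v ω ∂collisionMeasure d R) +
          ∫⁻ ω, B v ω ∂collisionMeasure d R) := lintegral_mono hpt
    _ ≤ ENNReal.ofReal A * (2 ^ d * τ * N + 2 ^ d * τ * N) := by
        rw [lintegral_const_mul' _ _ ENNReal.ofReal_ne_top, lintegral_add_right' _ hGm]
        gcongr
    _ = _ := by
        rw [bilinearConst, ENNReal.ofReal_mul hA, ENNReal.ofReal_mul (by norm_num),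
          ENNReal.ofReal_mul (by positivity), ENNReal.ofReal_pow (by norm_num),
          ENNReal.ofReal_toReal (measure_ne_top _ _), hN]
        simp only [ENNReal.ofReal_ofNat]
        ring

/-- The bilinear `L¹ × L² → L²` estimate for the projected collision operator. -/
theorem coeffNorm_galerkinForm_le (hd : d ≠ 0) (hL : 0 < L) (hRL : R ≤ L) {A : ℝ} (hA : 0 ≤ A)
    {k : EuclideanSpace ℝ (Fin d) × sphere (0 : EuclideanSpace ℝ (Fin d)) 1 → ℂ}
    (hk : AEStronglyMeasurable k (collisionMeasure d R))
    (hkA : ∀ᵐ ω ∂collisionMeasure d R, ‖k ω‖ ≤ A ∧ (ω ∉ forwardSet d → k ω = 0))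
    (Λ : Finset (Fin d → ℤ)) (x y : (Fin d → ℤ) → ℂ) :
    coeffNorm Λ (galerkinForm Λ (galerkinCoeff L R k) x y)
      ≤ A * bilinearConst d * (∫ v in velocityBox d L, ‖trigPoly L Λ x v‖) * coeffNorm Λ y := by
  have hki : Integrable k (collisionMeasure d R) :=
    Integrable.of_bound hk A (hkA.mono fun _ h => h.1)
  set Z := galerkinForm Λ (galerkinCoeff L R k) x y with hZ
  set Q : EuclideanSpace ℝ (Fin d) → ℂ := fun v =>
    ∑ p ∈ Λ, ∑ q ∈ Λ, galerkinCoeff L R k p q * (x p * y q) * fourierMode L (p + q) v with hQ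
  have hQc : Continuous Q := by fun_prop
  -- duality: the form is tested against its own trigonometric polynomial
  have h1 : ∫ v in velocityBox d L, Q v * (starRingEnd ℂ) (trigPoly L Λ Z v)
      = (((2 * L) ^ d * coeffNorm Λ Z ^ 2 : ℝ) : ℂ) := by
    have e : ∀ v, Q v * (starRingEnd ℂ) (trigPoly L Λ Z v)
        = ∑ m ∈ Λ, (starRingEnd ℂ) (Z m) * (Q v * (starRingEnd ℂ) (fourierMode L m v)) :=
      fun v => by
        rw [trigPoly, map_sum, Finset.mul_sum]
        exact Finset.sum_congr rfl fun m _ => by rw [map_mul]; ring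
    simp only [e]
    rw [integral_finsetSum _ fun m _ => ?_]
    · rw [coeffNorm, Real.sq_sqrt (by positivity), Finset.mul_sum, Complex.ofReal_sum]
      refine Finset.sum_congr rfl fun m _ => ?_
      rw [integral_const_mul, hQ, integral_sum_fourierMode_mul_conj hL Λ
        (fun p q => galerkinCoeff L R k p q * (x p * y q))]
      change _ * (_ * Z m) = _
      rw [Complex.ofReal_mul, Complex.ofReal_pow ‖Z m‖, ← Complex.conj_mul']
      ring
    · refine integrableOn_velocityBox ?_
      simp only [conj_fourierMode]
      fun_prop
  have h2 : ENNReal.ofReal ((2 * L) ^ d * coeffNorm Λ Z ^ 2)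
      ≤ ∫⁻ v in velocityBox d L, ‖Q v‖ₑ * ‖trigPoly L Λ Z v‖ₑ := by
    have e := enorm_integral_le_lintegral_enorm (μ := volume.restrict (velocityBox d L))
      (fun v => Q v * (starRingEnd ℂ) (trigPoly L Λ Z v))
    rw [h1] at e
    simp only [enorm_mul, RCLike.enorm_conj] at e
    refine le_trans (le_of_eq ?_) e
    rw [← ofReal_norm, Complex.norm_real, Real.norm_of_nonneg (by positivity)]
  have h3 := lintegral_collision_mul_le hd hL hRL hA hkA (continuous_trigPoly (L := L) Λ x)
    (continuous_trigPoly (L := L) Λ y) (continuous_trigPoly (L := L) Λ Z)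
    (boxPeriodic_trigPoly hL Λ x) (boxPeriodic_trigPoly hL Λ y) (boxPeriodic_trigPoly hL Λ Z)
  simp only [integral_collisionIntegrand_trigPoly hki Λ x y] at h3
  have h4 : ∫⁻ v in velocityBox d L, ‖trigPoly L Λ x v‖ₑ
      = ENNReal.ofReal (∫ v in velocityBox d L, ‖trigPoly L Λ x v‖) :=
    (ofReal_integral_norm_eq_lintegral_enorm
      (integrableOn_velocityBox (continuous_trigPoly Λ x))).symm
  have h5 : ∀ w : (Fin d → ℤ) → ℂ, (∫⁻ v in velocityBox d L, ‖trigPoly L Λ w v‖ₑ ^ 2) ^ (1 / 2 : ℝ)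
      = ENNReal.ofReal (√((2 * L) ^ d) * coeffNorm Λ w) := fun w => by
    rw [lintegral_enorm_sq_trigPoly hL, ENNReal.ofReal_rpow_of_nonneg
      (by have := coeffNorm_nonneg Λ w; positivity) (by positivity),
      ← Real.sqrt_eq_rpow, Real.sqrt_mul (by positivity), Real.sqrt_sq (coeffNorm_nonneg _ _)]
  rw [h4, h5, h5] at h3
  have hI : 0 ≤ ∫ v in velocityBox d L, ‖trigPoly L Λ x v‖ := integral_nonneg fun _ => norm_nonneg _
  have hb := bilinearConst_nonneg d
  have hy := coeffNorm_nonneg Λ y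
  have hz := coeffNorm_nonneg Λ Z
  rw [← ENNReal.ofReal_mul (by positivity), ← ENNReal.ofReal_mul (by positivity),
    ← ENNReal.ofReal_mul (by positivity)] at h3
  have h6 := (ENNReal.ofReal_le_ofReal_iff (by positivity)).1 (h2.trans h3)
  have hv : 0 < (2 * L) ^ d := by positivity
  have hs : √((2 * L) ^ d) * √((2 * L) ^ d) = (2 * L) ^ d := Real.mul_self_sqrt hv.le
  rcases hz.eq_or_lt with h0 | h0
  · rw [← h0]; positivity
  · refine le_of_mul_le_mul_right ?_ (mul_pos hv h0)
    calc _ = (2 * L) ^ d * coeffNorm Λ Z ^ 2 := by ring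
      _ ≤ _ := h6
      _ = A * bilinearConst d * (∫ v in velocityBox d L, ‖trigPoly L Λ x v‖) * coeffNorm Λ y *
          (√((2 * L) ^ d) * √((2 * L) ^ d) * coeffNorm Λ Z) := by ring
      _ = _ := by rw [hs]

end

/-! ### Partial derivatives of functions that depend on a parameter -/

section parameter

variable {n : ℕ} {S : Set (EuclideanSpace ℝ (Fin n))} {α : Type*} [MeasurableSpace α]
  {μ : Measure α}

theorem hasDerivAt_comp_add_single {g : EuclideanSpace ℝ (Fin n) → ℂ} (hg : DifferentiableOn ℝ g S)
    (i : Fin n) {z : EuclideanSpace ℝ (Fin n)} {τ : ℝ}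
    (hz : z + τ • EuclideanSpace.single i (1 : ℝ) ∈ interior S) :
    HasDerivAt (fun τ : ℝ => g (z + τ • EuclideanSpace.single i (1 : ℝ)))
      (partialWithin S i g (z + τ • EuclideanSpace.single i (1 : ℝ))) τ := by
  have hS := mem_interior_iff_mem_nhds.1 hz
  rw [partialWithin, fderivWithin_of_mem_nhds hS]
  have h1 : HasDerivAt (fun τ : ℝ => z + τ • EuclideanSpace.single i (1 : ℝ))
      ((1 : ℝ) • EuclideanSpace.single i (1 : ℝ)) τ :=
    ((hasDerivAt_id τ).smul_const _).const_add z
  rw [one_smul] at h1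
  exact ((hg.differentiableAt hS).hasFDerivAt).comp_hasDerivAt τ h1

theorem exists_pos_add_single_mem_interior {z : EuclideanSpace ℝ (Fin n)} (hz : z ∈ interior S)
    (i : Fin n) :
    ∃ ε > 0, ∀ τ : ℝ, |τ| < ε → z + τ • EuclideanSpace.single i (1 : ℝ) ∈ interior S := by
  obtain ⟨ε, hε, h⟩ := Metric.isOpen_iff.1 isOpen_interior z hz
  refine ⟨ε, hε, fun τ hτ => h ?_⟩
  simpa [norm_smul] using hτ

/-- At interior points partial derivatives are measurable in a parameter, as limits of difference
quotients. -/
theorem aestronglyMeasurable_partialWithin {F : α → EuclideanSpace ℝ (Fin n) → ℂ}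
    (hF : ∀ y ∈ interior S, AEStronglyMeasurable (fun a => F a y) μ)
    (hd : ∀ᵐ a ∂μ, DifferentiableOn ℝ (F a) S) (i : Fin n) {z : EuclideanSpace ℝ (Fin n)}
    (hz : z ∈ interior S) :
    AEStronglyMeasurable (fun a => partialWithin S i (F a) z) μ := by
  obtain ⟨ε, hε, hball⟩ := exists_pos_add_single_mem_interior hz i
  set τ : ℕ → ℝ := fun j => ε / 2 / (j + 1) with hτ
  have hτ0 : ∀ j, 0 < τ j := fun j => by positivity
  have hτε : ∀ j, |τ j| < ε := fun j => by
    rw [abs_of_pos (hτ0 j)]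
    refine (div_le_self (by positivity) ?_).trans_lt (half_lt_self hε)
    have : (0 : ℝ) ≤ j := j.cast_nonneg
    linarith
  have hlim : Filter.Tendsto τ Filter.atTop (nhdsWithin 0 {0}ᶜ) := by
    refine tendsto_nhdsWithin_iff.2 ⟨?_, Filter.Eventually.of_forall fun j => (hτ0 j).ne'⟩
    have := (tendsto_one_div_add_atTop_nhds_zero_nat (𝕜 := ℝ)).const_mul (ε / 2)
    simpa only [hτ, mul_zero, mul_one_div] using this
  refine aestronglyMeasurable_of_tendsto_ae Filter.atTop
    (f := fun j a => (τ j)⁻¹ • (F a (z + τ j • EuclideanSpace.single i (1 : ℝ)) - F a z))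
    (fun j => ((hF _ (hball _ (hτε j))).sub (hF z hz)).const_smul (τ j)⁻¹) ?_
  filter_upwards [hd] with a ha
  have h1 := hasDerivAt_comp_add_single ha i (z := z) (τ := 0) (by simpa using hz)
  have h2 := h1.tendsto_slope_zero.comp hlim
  simpa [Function.comp_def] using h2

theorem aestronglyMeasurable_wordDeriv (hS : UniqueDiffOn ℝ S) {r : ℕ}
    {F : α → EuclideanSpace ℝ (Fin n) → ℂ}
    (hF : ∀ y ∈ interior S, AEStronglyMeasurable (fun a => F a y) μ)
    (hd : ∀ᵐ a ∂μ, ContDiffOn ℝ r (F a) S) {w : List (Fin n)} (hw : w.length ≤ r)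
    {z : EuclideanSpace ℝ (Fin n)} (hz : z ∈ interior S) :
    AEStronglyMeasurable (fun a => wordDeriv S w (F a) z) μ := by
  induction w generalizing z with
  | nil => exact hF z hz
  | cons i w ih =>
    refine aestronglyMeasurable_partialWithin (F := fun a => wordDeriv S w (F a))
      (fun y hy => ih (by simp at hw; omega) hy) ?_ i hz
    filter_upwards [hd] with a ha
    exact differentiableOn_wordDeriv hS ha hw

/-- Differentiation under the integral sign at an interior point, for a function whose
differentiability is already known. -/
theorem partialWithin_eq_integral [IsFiniteMeasure μ] {F : α → EuclideanSpace ℝ (Fin n) → ℂ}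
    {G : EuclideanSpace ℝ (Fin n) → ℂ}
    (hF : ∀ y ∈ interior S, AEStronglyMeasurable (fun a => F a y) μ)
    (hd : ∀ᵐ a ∂μ, DifferentiableOn ℝ (F a) S) (hG : DifferentiableOn ℝ G S)
    (hFG : ∀ y ∈ interior S, G y = ∫ a, F a y ∂μ) (i : Fin n) {C : ℝ}
    (hC : ∀ᵐ a ∂μ, ∀ y ∈ interior S, ‖partialWithin S i (F a) y‖ ≤ C)
    {z : EuclideanSpace ℝ (Fin n)} (hz : z ∈ interior S) (hi : Integrable (fun a => F a z) μ) :
    partialWithin S i G z = ∫ a, partialWithin S i (F a) z ∂μ := by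
  obtain ⟨ε, hε, hball⟩ := exists_pos_add_single_mem_interior hz i
  have hmem : ∀ τ ∈ ball (0 : ℝ) ε, z + τ • EuclideanSpace.single i (1 : ℝ) ∈ interior S :=
    fun τ hτ => hball τ (by simpa using hτ)
  have h0 : z + (0 : ℝ) • EuclideanSpace.single i (1 : ℝ) = z := by simp
  have h1 := (hasDerivAt_integral_of_dominated_loc_of_deriv_le (μ := μ) (x₀ := (0 : ℝ))
    (s := ball 0 ε) (bound := fun _ => C)
    (F := fun τ a => F a (z + τ • EuclideanSpace.single i (1 : ℝ)))
    (F' := fun τ a => partialWithin S i (F a) (z + τ • EuclideanSpace.single i (1 : ℝ)))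
    (ball_mem_nhds 0 hε)
    (by filter_upwards [ball_mem_nhds (0 : ℝ) hε] with τ hτ using hF _ (hmem τ hτ))
    (by simpa only [h0] using hi)
    (by simpa only [h0] using aestronglyMeasurable_partialWithin hF hd i hz)
    (by filter_upwards [hC] with a ha τ hτ using ha _ (hmem τ hτ))
    (integrable_const C)
    (by filter_upwards [hd] with a ha τ hτ using hasDerivAt_comp_add_single ha i (hmem τ hτ))).2
  have h2 := hasDerivAt_comp_add_single hG i (z := z) (τ := 0) (by rwa [h0])
  simp only [h0] at h1 h2
  refine h2.unique (h1.congr_of_eventuallyEq ?_)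
  filter_upwards [ball_mem_nhds (0 : ℝ) hε] with τ hτ using hFG _ (hmem τ hτ)

end parameter

theorem integral_list_sum {α ι : Type*} [MeasurableSpace α] {μ : Measure α} (l : List ι)
    (f : ι → α → ℂ) (hf : ∀ j ∈ l, Integrable (f j) μ) :
    Integrable (fun a => (l.map fun j => f j a).sum) μ ∧
      ∫ a, (l.map fun j => f j a).sum ∂μ = (l.map fun j => ∫ a, f j a ∂μ).sum := by
  induction l with
  | nil => simp
  | cons j l ih =>
    obtain ⟨h1, h2⟩ := ih fun b hb => hf b (List.mem_cons_of_mem _ hb)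
    have hj := hf j List.mem_cons_self
    simp only [List.map_cons, List.sum_cons]
    exact ⟨hj.add h1, by rw [integral_add hj h1, h2]⟩

/-! ### The derivatives of the collision kernel -/

section kernel

variable {d n r : ℕ} {R L : ℝ} {Iz : Set (EuclideanSpace ℝ (Fin n))} {M Cb : ℝ≥0}
  {Φ : ℝ → ℝ} {b : ℝ → EuclideanSpace ℝ (Fin n) → ℝ}

/-- The symmetrized angular part of the kernel at a pair `(ξ, σ)`, as a function of `z`. -/
def angularPart (b : ℝ → EuclideanSpace ℝ (Fin n) → ℝ)
    (ω : EuclideanSpace ℝ (Fin d) × sphere (0 : EuclideanSpace ℝ (Fin d)) 1)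
    (z : EuclideanSpace ℝ (Fin n)) : ℂ :=
  (symmAngular (fun x => b x z)
    (inner ℝ (ω.2 : EuclideanSpace ℝ (Fin d)) (‖ω.1‖⁻¹ • ω.1)) : ℂ)

/-- The kernel `Φ(|ξ|) ∂_z^a b̃(σ ⋅ ξ / |ξ|, z)` for a word `a` of derivatives. -/
def kernelDeriv (Iz : Set (EuclideanSpace ℝ (Fin n))) (Φ : ℝ → ℝ)
    (b : ℝ → EuclideanSpace ℝ (Fin n) → ℝ) (a : List (Fin n)) (z : EuclideanSpace ℝ (Fin n))
    (ω : EuclideanSpace ℝ (Fin d) × sphere (0 : EuclideanSpace ℝ (Fin d)) 1) : ℂ :=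
  (Φ ‖ω.1‖ : ℂ) * wordDeriv Iz a (angularPart b ω) z

theorem inner_inv_norm_smul_mem_Icc
    (ω : EuclideanSpace ℝ (Fin d) × sphere (0 : EuclideanSpace ℝ (Fin d)) 1) :
    inner ℝ (ω.2 : EuclideanSpace ℝ (Fin d)) (‖ω.1‖⁻¹ • ω.1) ∈ Icc (-1 : ℝ) 1 := by
  refine abs_le.1 ((abs_real_inner_le_norm _ _).trans ?_)
  rw [norm_eq_of_mem_sphere, one_mul, norm_smul, norm_inv, norm_norm]
  exact inv_mul_le_one

theorem angularPart_eq_zero {ω : EuclideanSpace ℝ (Fin d) ×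
    sphere (0 : EuclideanSpace ℝ (Fin d)) 1} (hω : ω ∉ forwardSet d) :
    angularPart b ω = fun _ => 0 := by
  funext z
  have h : ¬ 0 ≤ inner ℝ (ω.2 : EuclideanSpace ℝ (Fin d)) (‖ω.1‖⁻¹ • ω.1) := by
    intro h
    apply hω
    rw [inner_smul_right] at h
    rcases eq_or_ne ω.1 0 with h0 | h0
    · simp [forwardSet, h0]
    · have := norm_pos_iff.2 h0
      exact nonneg_of_mul_nonneg_right h (by positivity)
  simp [angularPart, symmAngular, h]

theorem angularPart_eq_sum {ω : EuclideanSpace ℝ (Fin d) ×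
    sphere (0 : EuclideanSpace ℝ (Fin d)) 1} (hω : ω ∈ forwardSet d) :
    angularPart b ω = fun z => ∑ j : Bool, (1 : ℂ) * (b (if j then
      inner ℝ (ω.2 : EuclideanSpace ℝ (Fin d)) (‖ω.1‖⁻¹ • ω.1) else
      -inner ℝ (ω.2 : EuclideanSpace ℝ (Fin d)) (‖ω.1‖⁻¹ • ω.1)) z : ℂ) := by
  funext z
  have h : 0 ≤ inner ℝ (ω.2 : EuclideanSpace ℝ (Fin d)) (‖ω.1‖⁻¹ • ω.1) := by
    rw [inner_smul_right]
    exact mul_nonneg (by positivity) hω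
  simp [angularPart, symmAngular, h]

theorem wordDeriv_zero {m : ℕ} (S : Set (EuclideanSpace ℝ (Fin m))) (w : List (Fin m)) :
    wordDeriv S w (fun _ => 0) = fun _ => 0 := by
  induction w with
  | nil => rfl
  | cons i w ih => rw [wordDeriv_cons, ih]; funext x; simp [partialWithin]

theorem contDiffOn_angularPart (hK : KernelAssumptions d r R L Iz M Cb Φ b)
    (ω : EuclideanSpace ℝ (Fin d) × sphere (0 : EuclideanSpace ℝ (Fin d)) 1) :
    ContDiffOn ℝ r (angularPart b ω) Iz := by
  by_cases hω : ω ∈ forwardSet d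
  · rw [angularPart_eq_sum hω]
    have hc := inner_inv_norm_smul_mem_Icc ω
    refine ContDiffOn.sum fun j _ => contDiffOn_const.mul
      (Complex.ofRealCLM.contDiff.comp_contDiffOn (hK.angular_contDiff _ ?_))
    cases j
    · exact ⟨by simp; exact hc.2, by simp; linarith [hc.1]⟩
    · exact hc
  · rw [angularPart_eq_zero hω]
    exact contDiffOn_const

theorem norm_wordDeriv_angularPart_le (hIz : UniqueDiffOn ℝ Iz)
    (hK : KernelAssumptions d r R L Iz M Cb Φ b)
    (ω : EuclideanSpace ℝ (Fin d) × sphere (0 : EuclideanSpace ℝ (Fin d)) 1)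
    {a : List (Fin n)} (ha : a.Pairwise (· ≤ ·)) (har : a.length ≤ r)
    {z : EuclideanSpace ℝ (Fin n)} (hz : z ∈ Iz) :
    ‖wordDeriv Iz a (angularPart b ω) z‖ ≤ 2 * Cb := by
  by_cases hω : ω ∈ forwardSet d
  · rw [angularPart_eq_sum hω]
    have hc := inner_inv_norm_smul_mem_Icc ω
    have hmem : ∀ j : Bool, (if j then
      inner ℝ (ω.2 : EuclideanSpace ℝ (Fin d)) (‖ω.1‖⁻¹ • ω.1) else
      -inner ℝ (ω.2 : EuclideanSpace ℝ (Fin d)) (‖ω.1‖⁻¹ • ω.1)) ∈ Icc (-1 : ℝ) 1 := fun j => by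
      cases j
      · exact ⟨by simp; exact hc.2, by simp; linarith [hc.1]⟩
      · exact hc
    obtain ⟨l, rfl⟩ := exists_eq_wordOf ha
    rw [wordDeriv_sum_const_mul hIz (r := r) Finset.univ (fun _ : Bool => (1 : ℂ))
      (fun j z => (b (if j then _ else _) z : ℂ))
      (fun j _ => Complex.ofRealCLM.contDiff.comp_contDiffOn (hK.angular_contDiff _ (hmem j)))
      har hz]
    refine (norm_sum_le _ _).trans ?_
    rw [Fintype.sum_bool, two_mul]
    simp only [one_mul, ← multiDeriv_eq_wordDeriv]
    have hl : l ∈ multiIdx n r := by rwa [mem_multiIdx, ← length_wordOf]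
    exact add_le_add (hK.angular_bound _ (hmem true) z hz l hl)
      (hK.angular_bound _ (hmem false) z hz l hl)
  · rw [angularPart_eq_zero hω, wordDeriv_zero, norm_zero]
    positivity

theorem measurable_angularPart (hK : KernelAssumptions d r R L Iz M Cb Φ b)
    {z : EuclideanSpace ℝ (Fin n)} (hz : z ∈ Iz) :
    Measurable fun ω : EuclideanSpace ℝ (Fin d) × sphere (0 : EuclideanSpace ℝ (Fin d)) 1 =>
      angularPart b ω z := by
  have h1 : Measurable (symmAngular fun x => b x z) := by
    unfold symmAngular
    exact Measurable.ite measurableSet_Ici ((hK.angular_measurable z hz).add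
      ((hK.angular_measurable z hz).comp measurable_neg)) measurable_const
  refine Complex.measurable_ofReal.comp (h1.comp ?_)
  exact measurable_subtype_coe.comp measurable_snd |>.inner (by fun_prop)

theorem ae_norm_kinetic_le (hK : KernelAssumptions d r R L Iz M Cb Φ b) (hRL : R ≤ L) :
    ∀ᵐ ω : EuclideanSpace ℝ (Fin d) × sphere (0 : EuclideanSpace ℝ (Fin d)) 1
      ∂collisionMeasure d R, ‖(Φ ‖ω.1‖ : ℂ)‖ ≤ M := by
  have h1 := hK.kinetic_bound
  rw [eLpNorm_exponent_top] at h1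
  have h2 := enorm_ae_le_eLpNormEssSup
    ((closedBall (0 : EuclideanSpace ℝ (Fin d)) R).indicator fun q => Φ ‖q‖)
    (volume.restrict (velocityBox d L))
  have h3 : ∀ᵐ q ∂volume.restrict (closedBall (0 : EuclideanSpace ℝ (Fin d)) R),
      ‖(Φ ‖q‖ : ℂ)‖ ≤ M := by
    filter_upwards [ae_mono (Measure.restrict_mono_set volume
      (closedBall_subset_velocityBox hRL)) h2,
      ae_restrict_mem measurableSet_closedBall] with q hq hm
    rw [indicator_of_mem hm] at hq
    have h4 := hq.trans h1
    rw [Complex.norm_real]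
    rw [enorm_eq_nnnorm, ENNReal.coe_le_coe] at h4
    exact_mod_cast h4
  have := isFiniteMeasure_closedBall d R
  exact Measure.quasiMeasurePreserving_fst.ae h3

theorem aestronglyMeasurable_kernelDeriv (hIz : UniqueDiffOn ℝ Iz)
    (hK : KernelAssumptions d r R L Iz M Cb Φ b) {a : List (Fin n)} (har : a.length ≤ r)
    {z : EuclideanSpace ℝ (Fin n)} (hz : z ∈ interior Iz) :
    AEStronglyMeasurable (kernelDeriv Iz Φ b a z) (collisionMeasure d R) := by
  refine AEStronglyMeasurable.mul ?_ ?_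
  · exact (Complex.measurable_ofReal.comp
      (hK.kinetic_measurable.comp (by fun_prop))).aestronglyMeasurable
  · exact aestronglyMeasurable_wordDeriv hIz
      (fun y hy => (measurable_angularPart hK (interior_subset hy)).aestronglyMeasurable)
      (Filter.Eventually.of_forall fun ω => contDiffOn_angularPart hK ω) har hz

theorem ae_norm_kernelDeriv_le (hIz : UniqueDiffOn ℝ Iz)
    (hK : KernelAssumptions d r R L Iz M Cb Φ b) (hRL : R ≤ L) :
    ∀ᵐ ω ∂collisionMeasure d R, ∀ a : List (Fin n), a.Pairwise (· ≤ ·) → a.length ≤ r →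
      ∀ z ∈ Iz, ‖kernelDeriv Iz Φ b a z ω‖ ≤ M * (2 * Cb) ∧
        (ω ∉ forwardSet d → kernelDeriv Iz Φ b a z ω = 0) := by
  filter_upwards [ae_norm_kinetic_le hK hRL] with ω hω a ha har z hz
  refine ⟨?_, fun h => ?_⟩
  · rw [kernelDeriv, norm_mul]
    gcongr
    exact norm_wordDeriv_angularPart_le hIz hK ω ha har hz
  · rw [kernelDeriv, angularPart_eq_zero h, wordDeriv_zero, mul_zero]

theorem integrable_kernelDeriv (hIz : UniqueDiffOn ℝ Iz)
    (hK : KernelAssumptions d r R L Iz M Cb Φ b) (hRL : R ≤ L) {a : List (Fin n)}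
    (ha : a.Pairwise (· ≤ ·)) (har : a.length ≤ r) {z : EuclideanSpace ℝ (Fin n)}
    (hz : z ∈ interior Iz) : Integrable (kernelDeriv Iz Φ b a z) (collisionMeasure d R) :=
  Integrable.of_bound (aestronglyMeasurable_kernelDeriv hIz hK har hz) (M * (2 * Cb))
    ((ae_norm_kernelDeriv_le hIz hK hRL).mono fun _ h =>
      (h a ha har z (interior_subset hz)).1)

end kernel

/-! ### The differentiated Galerkin system -/

section

variable {d n r : ℕ} {R L : ℝ} {Iz : Set (EuclideanSpace ℝ (Fin n))} {M Cb : ℝ≥0}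
  {Φ : ℝ → ℝ} {b : ℝ → EuclideanSpace ℝ (Fin n) → ℝ} {Λ : Finset (Fin d → ℤ)} {t₀ : ℝ}
  {c : ℝ → EuclideanSpace ℝ (Fin n) → (Fin d → ℤ) → ℂ}

theorem fourierCoefficient_collision (hL : 0 < L) (x : (Fin d → ℤ) → ℂ)
    {z : EuclideanSpace ℝ (Fin n)}
    (hk : Integrable (kernelDeriv Iz Φ b [] z) (collisionMeasure d R)) (m : Fin d → ℤ) :
    fourierCoefficient L (collision R Φ (fun s => b s z) (trigPoly L Λ x) (trigPoly L Λ x)) m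
      = galerkinForm Λ (galerkinCoeff L R (kernelDeriv Iz Φ b [] z)) x x m := by
  have := isFiniteMeasure_closedBall d R
  have h1 : ∀ v, collision R Φ (fun s => b s z) (trigPoly L Λ x) (trigPoly L Λ x) v
      = ∑ p ∈ Λ, ∑ q ∈ Λ, galerkinCoeff L R (kernelDeriv Iz Φ b [] z) p q * (x p * x q) *
          fourierMode L (p + q) v := fun v => by
    rw [← integral_collisionIntegrand_trigPoly hk, integral_prod _
      (integrable_collisionIntegrand_trigPoly hk Λ x x v)]
    simp only [collision, kernelDeriv, wordDeriv_nil, angularPart, Complex.ofReal_mul]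
  rw [fourierCoefficient]
  simp only [h1]
  rw [integral_sum_fourierMode_mul_conj hL Λ
    (fun p q => galerkinCoeff L R (kernelDeriv Iz Φ b [] z) p q * (x p * x q)), ← mul_assoc,
    ← Complex.ofReal_mul, inv_mul_cancel₀ (by positivity), Complex.ofReal_one, one_mul]
  rfl

theorem norm_galerkinForm_le {β : (Fin d → ℤ) → (Fin d → ℤ) → ℂ} {x y : (Fin d → ℤ) → ℂ}
    {B X : ℝ} (hβ : ∀ p q, ‖β p q‖ ≤ B) (hx : ∀ p ∈ Λ, ‖x p‖ ≤ X)
    (hy : ∀ p ∈ Λ, ‖y p‖ ≤ X) (m : Fin d → ℤ) :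
    ‖galerkinForm Λ β x y m‖ ≤ ∑ _p ∈ Λ, ∑ _q ∈ Λ, B * (X * X) := by
  refine norm_sum_le_of_le _ fun p hp => norm_sum_le_of_le _ fun q hq => ?_
  have hB : 0 ≤ B := (norm_nonneg _).trans (hβ p q)
  have hX : 0 ≤ X := (norm_nonneg _).trans (hx p hp)
  split_ifs
  · rw [norm_mul, norm_mul]
    gcongr
    exacts [hβ p q, hx p hp, hy q hq]
  · rw [norm_zero]; positivity

/-- The derivative `∂_z^w c_m(t, z)` of the coefficients. -/
def coeffDeriv (Iz : Set (EuclideanSpace ℝ (Fin n)))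
    (c : ℝ → EuclideanSpace ℝ (Fin n) → (Fin d → ℤ) → ℂ) (w : List (Fin n)) (t : ℝ)
    (z : EuclideanSpace ℝ (Fin n)) (m : Fin d → ℤ) : ℂ :=
  wordDeriv Iz w (fun y => c t y m) z

/-- The Leibniz expansion of `∂_z^w ∑_{p+q=m} β(p, q) c_p c_q`, for a matrix `β` whose derivatives
are `β'`. -/
def leibnizForm (Λ : Finset (Fin d → ℤ)) (β' : List (Fin n) → (Fin d → ℤ) → (Fin d → ℤ) → ℂ)
    (x : List (Fin n) → (Fin d → ℤ) → ℂ) (w : List (Fin n)) (m : Fin d → ℤ) : ℂ :=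
  ((splits w).map fun p => ((splits p.2).map fun q =>
    galerkinForm Λ (β' p.1) (x q.1) (x q.2) m).sum).sum

/-- The right-hand side of the equation for `∂_z^w c_m`. -/
def galerkinDeriv (L R : ℝ) (Iz : Set (EuclideanSpace ℝ (Fin n))) (Φ : ℝ → ℝ)
    (b : ℝ → EuclideanSpace ℝ (Fin n) → ℝ) (Λ : Finset (Fin d → ℤ))
    (c : ℝ → EuclideanSpace ℝ (Fin n) → (Fin d → ℤ) → ℂ) (w : List (Fin n)) (t : ℝ)
    (z : EuclideanSpace ℝ (Fin n)) (m : Fin d → ℤ) : ℂ :=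
  leibnizForm Λ (fun a => galerkinCoeff L R (kernelDeriv Iz Φ b a z))
    (fun u => coeffDeriv Iz c u t z) w m

/-- The integrand of `galerkinDeriv` at a pair `(ξ, σ)`. -/
def galerkinIntegrand (L : ℝ) (Iz : Set (EuclideanSpace ℝ (Fin n))) (Φ : ℝ → ℝ)
    (b : ℝ → EuclideanSpace ℝ (Fin n) → ℝ) (Λ : Finset (Fin d → ℤ))
    (c : ℝ → EuclideanSpace ℝ (Fin n) → (Fin d → ℤ) → ℂ) (w : List (Fin n))
    (z : EuclideanSpace ℝ (Fin n)) (m : Fin d → ℤ)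
    (a : ℝ × (EuclideanSpace ℝ (Fin d) × sphere (0 : EuclideanSpace ℝ (Fin d)) 1)) : ℂ :=
  leibnizForm Λ (fun u p q => kernelDeriv Iz Φ b u z a.2 * collisionPhase L p q a.2)
    (fun u => coeffDeriv Iz c u a.1 z) w m

/-- A solution of the Galerkin system whose coefficients have bounded derivatives in `z`. -/
structure BoundedSolution (d : ℕ) {n : ℕ} (r : ℕ) (R L : ℝ) (Iz : Set (EuclideanSpace ℝ (Fin n)))
    (M Cb : ℝ≥0) (Φ : ℝ → ℝ) (b : ℝ → EuclideanSpace ℝ (Fin n) → ℝ) (Λ : Finset (Fin d → ℤ))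
    (t₀ : ℝ) (c : ℝ → EuclideanSpace ℝ (Fin n) → (Fin d → ℤ) → ℂ) (X : ℝ) : Prop where
  uniqueDiffOn : UniqueDiffOn ℝ Iz
  kernel : KernelAssumptions d r R L Iz M Cb Φ b
  solution : IsNumericalSolution r R L Iz Φ b Λ t₀ c
  pos : 0 < L
  le : R ≤ L
  norm_le : ∀ w : List (Fin n), w.Pairwise (· ≤ ·) → w.length ≤ r → ∀ t ∈ Icc 0 t₀, ∀ z ∈ Iz,
    ∀ m ∈ Λ, ‖coeffDeriv Iz c w t z m‖ ≤ X

theorem list_sum_finset_sum {ι κ : Type*} (l : List ι) (s : Finset κ) (f : ι → κ → ℂ) :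
    (l.map fun j => ∑ a ∈ s, f j a).sum = ∑ a ∈ s, (l.map fun j => f j a).sum := by
  induction l with
  | nil => simp
  | cons j l ih => simp only [List.map_cons, List.sum_cons, ih, Finset.sum_add_distrib]

theorem galerkinForm_eq_sum_filter (β : (Fin d → ℤ) → (Fin d → ℤ) → ℂ) (x y : (Fin d → ℤ) → ℂ)
    (m : Fin d → ℤ) :
    galerkinForm Λ β x y m = ∑ j ∈ (Λ ×ˢ Λ).filter (fun j => j.1 + j.2 = m),
      β j.1 j.2 * (x j.1 * y j.2) := by
  rw [galerkinForm, Finset.sum_filter, Finset.sum_product]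

theorem wordDeriv_galerkinForm {X : ℝ} (h : BoundedSolution d r R L Iz M Cb Φ b Λ t₀ c X)
    {w : List (Fin n)} (hw : w.length ≤ r) (m : Fin d → ℤ)
    {a : ℝ × (EuclideanSpace ℝ (Fin d) × sphere (0 : EuclideanSpace ℝ (Fin d)) 1)}
    (ha : a.1 ∈ Icc 0 t₀) :
    EqOn (wordDeriv Iz w fun y => galerkinIntegrand L Iz Φ b Λ c [] y m a)
      (fun z => galerkinIntegrand L Iz Φ b Λ c w z m a) Iz := by
  have hS := h.uniqueDiffOn
  have e1 : (fun y => galerkinIntegrand L Iz Φ b Λ c [] y m a)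
      = fun y => ∑ j ∈ (Λ ×ˢ Λ).filter (fun j => j.1 + j.2 = m),
        (Φ ‖a.2.1‖ * collisionPhase L j.1 j.2 a.2) *
          (angularPart b a.2 y * (c a.1 y j.1 * c a.1 y j.2)) := by
    funext y
    simp only [galerkinIntegrand, leibnizForm, splits, List.map_cons, List.map_nil,
      List.sum_cons, List.sum_nil, add_zero, galerkinForm_eq_sum_filter, kernelDeriv, coeffDeriv,
      wordDeriv_nil]
    exact Finset.sum_congr rfl fun j _ => by ring
  have hc : ∀ m ∈ Λ, ContDiffOn ℝ r (fun y => c a.1 y m) Iz := h.solution.contDiffOn a.1 ha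
  have hB := contDiffOn_angularPart h.kernel a.2
  have hmem : ∀ j ∈ (Λ ×ˢ Λ).filter (fun j => j.1 + j.2 = m), j.1 ∈ Λ ∧ j.2 ∈ Λ := fun j hj =>
    Finset.mem_product.1 (Finset.mem_filter.1 hj).1
  intro z hz
  rw [e1, wordDeriv_sum_const_mul hS (r := r) _ _
    (fun j y => angularPart b a.2 y * (c a.1 y j.1 * c a.1 y j.2))
    (fun j hj => hB.mul ((hc _ (hmem j hj).1).mul (hc _ (hmem j hj).2))) hw hz]
  simp only [galerkinIntegrand, leibnizForm, galerkinForm_eq_sum_filter, list_sum_finset_sum]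
  refine Finset.sum_congr rfl fun j hj => ?_
  rw [wordDeriv_mul hS hB ((hc _ (hmem j hj).1).mul (hc _ (hmem j hj).2)) hw hz,
    ← List.sum_map_mul_left]
  refine congrArg List.sum (List.map_congr_left fun p hp => ?_)
  have hp2 : p.2.length ≤ r := by
    have := length_add_length_of_mem_splits hp
    omega
  rw [wordDeriv_mul hS (hc _ (hmem j hj).1) (hc _ (hmem j hj).2) hp2 hz, ← List.sum_map_mul_left,
    ← List.sum_map_mul_left]
  refine congrArg List.sum (List.map_congr_left fun q _ => ?_)
  simp only [kernelDeriv, coeffDeriv]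
  ring

/-- Both parts of a splitting of a sorted word are sorted and not longer than the word. -/
theorem sorted_of_mem_splits {w : List (Fin n)} (hw : w.Pairwise (· ≤ ·)) (hr : w.length ≤ r)
    {p : List (Fin n) × List (Fin n)} (hp : p ∈ splits w) :
    (p.1.Pairwise (· ≤ ·) ∧ p.1.length ≤ r) ∧ (p.2.Pairwise (· ≤ ·) ∧ p.2.length ≤ r) := by
  obtain ⟨h1, h2⟩ := sublist_of_mem_splits hp
  exact ⟨⟨hw.sublist h1, h1.length_le.trans hr⟩, ⟨hw.sublist h2, h2.length_le.trans hr⟩⟩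

/-- The exceptional null set does not depend on `z`, as needed for dominated convergence. -/
theorem norm_galerkinIntegrand_le {X : ℝ} (h : BoundedSolution d r R L Iz M Cb Φ b Λ t₀ c X)
    {w : List (Fin n)} (hw : w.Pairwise (· ≤ ·)) (hr : w.length ≤ r) (m : Fin d → ℤ) :
    ∃ C : ℝ, ∀ᵐ ω ∂collisionMeasure d R, ∀ s ∈ Icc 0 t₀, ∀ z ∈ Iz,
      ‖galerkinIntegrand L Iz Φ b Λ c w z m (s, ω)‖ ≤ C := by
  refine ⟨((splits w).map fun p => ((splits p.2).map fun _ =>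
    ∑ _p ∈ Λ, ∑ _q ∈ Λ, M * (2 * Cb) * 2 * (X * X)).sum).sum, ?_⟩
  filter_upwards [ae_norm_kernelDeriv_le h.uniqueDiffOn h.kernel h.le] with ω hω s hs z hz
  refine norm_list_sum_map_le _ _ _ fun p hp => norm_list_sum_map_le _ _ _ fun q hq => ?_
  obtain ⟨h1, h2⟩ := sorted_of_mem_splits hw hr hp
  obtain ⟨h3, h4⟩ := sorted_of_mem_splits h2.1 h2.2 hq
  refine norm_galerkinForm_le (fun P Q => ?_) (fun P hP => ?_) (fun P hP => ?_) m
  · rw [norm_mul]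
    gcongr
    · exact (hω _ h1.1 h1.2 z hz).1
    · exact norm_collisionPhase_le _ _ _
  · exact h.norm_le _ h3.1 h3.2 s hs z hz P hP
  · exact h.norm_le _ h4.1 h4.2 s hs z hz P hP

theorem aestronglyMeasurable_coeffDeriv {X : ℝ}
    (h : BoundedSolution d r R L Iz M Cb Φ b Λ t₀ c X) {w : List (Fin n)} (hr : w.length ≤ r)
    {t : ℝ} (ht : t ∈ Icc 0 t₀) {z : EuclideanSpace ℝ (Fin n)} (hz : z ∈ interior Iz)
    {m : Fin d → ℤ} (hm : m ∈ Λ) :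
    AEStronglyMeasurable (fun s => coeffDeriv Iz c w s z m) (volume.restrict (Ioc 0 t)) := by
  have hsub : Ioc 0 t ⊆ Icc 0 t₀ := fun s hs => ⟨hs.1.le, hs.2.trans ht.2⟩
  refine aestronglyMeasurable_wordDeriv h.uniqueDiffOn (r := r) (F := fun s y => c s y m)
    (fun y hy => ?_) ?_ hr hz
  · exact ((h.solution.continuousOn y (interior_subset hy) m hm).mono hsub).aestronglyMeasurable
      measurableSet_Ioc
  · filter_upwards [ae_restrict_mem measurableSet_Ioc] with s hs
    exact h.solution.contDiffOn s (hsub hs) m hm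

theorem aestronglyMeasurable_list_sum {α ι : Type*} [MeasurableSpace α] {μ : Measure α}
    (l : List ι) (f : ι → α → ℂ) (hf : ∀ j ∈ l, AEStronglyMeasurable (f j) μ) :
    AEStronglyMeasurable (fun a => (l.map fun j => f j a).sum) μ := by
  induction l with
  | nil => simpa using aestronglyMeasurable_const
  | cons j l ih =>
    simp only [List.map_cons, List.sum_cons]
    exact (hf j List.mem_cons_self).add (ih fun b hb => hf b (List.mem_cons_of_mem _ hb))

theorem aestronglyMeasurable_galerkinIntegrand {X : ℝ}
    (h : BoundedSolution d r R L Iz M Cb Φ b Λ t₀ c X) {w : List (Fin n)}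
    (hw : w.Pairwise (· ≤ ·)) (hr : w.length ≤ r) {t : ℝ} (ht : t ∈ Icc 0 t₀)
    {z : EuclideanSpace ℝ (Fin n)} (hz : z ∈ interior Iz) (m : Fin d → ℤ) :
    AEStronglyMeasurable (galerkinIntegrand L Iz Φ b Λ c w z m)
      ((volume.restrict (Ioc 0 t)).prod (collisionMeasure d R)) := by
  refine aestronglyMeasurable_list_sum _ _ fun p hp => aestronglyMeasurable_list_sum _ _
    fun q hq => ?_
  obtain ⟨h1, h2⟩ := sorted_of_mem_splits hw hr hp
  obtain ⟨h3, h4⟩ := sorted_of_mem_splits h2.1 h2.2 hq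
  simp only [galerkinForm]
  refine Finset.aestronglyMeasurable_fun_sum _ fun P hP =>
    Finset.aestronglyMeasurable_fun_sum _ fun Q hQ => ?_
  split_ifs
  · exact (((aestronglyMeasurable_kernelDeriv h.uniqueDiffOn h.kernel h1.2 hz).comp_snd).mul
      ((continuous_collisionPhase P Q).comp continuous_snd).aestronglyMeasurable).mul
      ((aestronglyMeasurable_coeffDeriv h h3.2 ht hz hP).comp_fst.mul
        (aestronglyMeasurable_coeffDeriv h h4.2 ht hz hQ).comp_fst)
  · exact aestronglyMeasurable_const

theorem ae_prod_norm_galerkinIntegrand_le {X : ℝ}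
    (h : BoundedSolution d r R L Iz M Cb Φ b Λ t₀ c X) {w : List (Fin n)}
    (hw : w.Pairwise (· ≤ ·)) (hr : w.length ≤ r) (m : Fin d → ℤ) :
    ∃ C : ℝ, ∀ t ∈ Icc 0 t₀, ∀ᵐ a ∂(volume.restrict (Ioc 0 t)).prod (collisionMeasure d R),
      a.1 ∈ Icc 0 t₀ ∧ ∀ z ∈ Iz, ‖galerkinIntegrand L Iz Φ b Λ c w z m a‖ ≤ C := by
  obtain ⟨C, hC⟩ := norm_galerkinIntegrand_le h hw hr m
  refine ⟨C, fun t ht => ?_⟩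
  have h1 : ∀ᵐ s ∂volume.restrict (Ioc 0 t), s ∈ Icc 0 t₀ := by
    filter_upwards [ae_restrict_mem measurableSet_Ioc] with s hs
    exact ⟨hs.1.le, hs.2.trans ht.2⟩
  filter_upwards [Measure.quasiMeasurePreserving_fst.ae h1,
    Measure.quasiMeasurePreserving_snd.ae hC] with a ha1 ha2
  exact ⟨ha1, fun z hz => ha2 a.1 ha1 z hz⟩

theorem integrable_galerkinIntegrand {X : ℝ}
    (h : BoundedSolution d r R L Iz M Cb Φ b Λ t₀ c X) {w : List (Fin n)}
    (hw : w.Pairwise (· ≤ ·)) (hr : w.length ≤ r) {t : ℝ} (ht : t ∈ Icc 0 t₀)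
    {z : EuclideanSpace ℝ (Fin n)} (hz : z ∈ interior Iz) (m : Fin d → ℤ) :
    Integrable (galerkinIntegrand L Iz Φ b Λ c w z m)
      ((volume.restrict (Ioc 0 t)).prod (collisionMeasure d R)) := by
  obtain ⟨C, hC⟩ := ae_prod_norm_galerkinIntegrand_le h hw hr m
  exact Integrable.of_bound (aestronglyMeasurable_galerkinIntegrand h hw hr ht hz m) C
    ((hC t ht).mono fun a ha => ha.2 z (interior_subset hz))

theorem integral_galerkinIntegrand {X : ℝ}
    (h : BoundedSolution d r R L Iz M Cb Φ b Λ t₀ c X) {w : List (Fin n)}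
    (hw : w.Pairwise (· ≤ ·)) (hr : w.length ≤ r)
    {z : EuclideanSpace ℝ (Fin n)} (hz : z ∈ interior Iz) (m : Fin d → ℤ) (s : ℝ) :
    ∫ ω, galerkinIntegrand L Iz Φ b Λ c w z m (s, ω) ∂collisionMeasure d R
      = galerkinDeriv L R Iz Φ b Λ c w s z m := by
  have key : ∀ p ∈ splits w, ∀ q ∈ splits p.2,
      Integrable (fun ω => galerkinForm Λ (fun P Q => kernelDeriv Iz Φ b p.1 z ω *
        collisionPhase L P Q ω) (coeffDeriv Iz c q.1 s z) (coeffDeriv Iz c q.2 s z) m)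
        (collisionMeasure d R) ∧
      ∫ ω, galerkinForm Λ (fun P Q => kernelDeriv Iz Φ b p.1 z ω *
        collisionPhase L P Q ω) (coeffDeriv Iz c q.1 s z) (coeffDeriv Iz c q.2 s z) m
        ∂collisionMeasure d R = galerkinForm Λ (galerkinCoeff L R (kernelDeriv Iz Φ b p.1 z))
          (coeffDeriv Iz c q.1 s z) (coeffDeriv Iz c q.2 s z) m := by
    intro p hp q hq
    obtain ⟨h1, h2⟩ := sorted_of_mem_splits hw hr hp
    have hki := integrable_kernelDeriv h.uniqueDiffOn h.kernel h.le h1.1 h1.2 hz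
    have hi : ∀ j : (Fin d → ℤ) × (Fin d → ℤ), Integrable (fun ω => kernelDeriv Iz Φ b p.1 z ω *
        collisionPhase L j.1 j.2 ω * (coeffDeriv Iz c q.1 s z j.1 * coeffDeriv Iz c q.2 s z j.2))
        (collisionMeasure d R) := fun j =>
      (integrable_mul_collisionPhase hki j.1 j.2).mul_const _
    simp only [galerkinForm_eq_sum_filter]
    refine ⟨integrable_finsetSum _ fun j _ => hi j, ?_⟩
    rw [integral_finsetSum _ fun j _ => hi j]
    exact Finset.sum_congr rfl fun j _ => integral_mul_const _ _
  simp only [galerkinIntegrand, galerkinDeriv, leibnizForm]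
  rw [(integral_list_sum (splits w) _ fun p hp => (integral_list_sum (splits p.2) _
    fun q hq => (key p hp q hq).1).1).2]
  refine congrArg List.sum (List.map_congr_left fun p hp => ?_)
  rw [(integral_list_sum (splits p.2) _ fun q hq => (key p hp q hq).1).2]
  exact congrArg List.sum (List.map_congr_left fun q hq => (key p hp q hq).2)

theorem intervalIntegral_galerkinDeriv {X : ℝ}
    (h : BoundedSolution d r R L Iz M Cb Φ b Λ t₀ c X) {w : List (Fin n)}
    (hw : w.Pairwise (· ≤ ·)) (hr : w.length ≤ r) {t : ℝ} (ht : t ∈ Icc 0 t₀)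
    {z : EuclideanSpace ℝ (Fin n)} (hz : z ∈ interior Iz) (m : Fin d → ℤ) :
    IntegrableOn (fun s => galerkinDeriv L R Iz Φ b Λ c w s z m) (Ioc 0 t) ∧
    ∫ s in (0 : ℝ)..t, galerkinDeriv L R Iz Φ b Λ c w s z m
      = ∫ a, galerkinIntegrand L Iz Φ b Λ c w z m a
          ∂(volume.restrict (Ioc 0 t)).prod (collisionMeasure d R) := by
  have hi := integrable_galerkinIntegrand h hw hr ht hz m
  rw [integral_prod _ hi, intervalIntegral.integral_of_le ht.1]
  have h2 := hi.integral_prod_left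
  simp only [integral_galerkinIntegrand h hw hr hz] at h2 ⊢
  exact ⟨h2, trivial⟩

/-- The differentiated system in integrated form. As the coefficients are known to be
differentiable in `z`, each differentiation is one application of dominated convergence. -/
theorem coeffDeriv_eq_add_integral {X : ℝ}
    (h : BoundedSolution d r R L Iz M Cb Φ b Λ t₀ c X) {w : List (Fin n)}
    (hw : w.Pairwise (· ≤ ·)) (hr : w.length ≤ r) {t : ℝ} (ht : t ∈ Icc 0 t₀)
    {z : EuclideanSpace ℝ (Fin n)} (hz : z ∈ interior Iz) {m : Fin d → ℤ} (hm : m ∈ Λ) :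
    coeffDeriv Iz c w t z m = coeffDeriv Iz c w 0 z m
      + ∫ s in (0 : ℝ)..t, galerkinDeriv L R Iz Φ b Λ c w s z m := by
  have h0 : (0 : ℝ) ∈ Icc 0 t₀ := ⟨le_rfl, ht.1.trans ht.2⟩
  have hS := h.uniqueDiffOn
  induction w generalizing z with
  | nil =>
    have hzI := interior_subset hz
    have hki := integrable_kernelDeriv hS h.kernel h.le (a := []) hw hr hz
    have e1 : ∀ s, galerkinDeriv L R Iz Φ b Λ c [] s z m
        = galerkinForm Λ (galerkinCoeff L R (kernelDeriv Iz Φ b [] z)) (c s z) (c s z) m := by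
      intro s
      simp only [galerkinDeriv, leibnizForm, splits, List.map_cons, List.map_nil, List.sum_cons,
        List.sum_nil, add_zero]
      rfl
    have hc : ContinuousOn (fun s => galerkinDeriv L R Iz Φ b Λ c [] s z m) (Icc 0 t₀) := by
      simp only [e1, galerkinForm]
      refine continuousOn_finsetSum _ fun p hp => continuousOn_finsetSum _ fun q hq => ?_
      split_ifs
      · exact continuousOn_const.mul ((h.solution.continuousOn z hzI p hp).mul
          (h.solution.continuousOn z hzI q hq))
      · exact continuousOn_const
    have hsub : Icc 0 t ⊆ Icc 0 t₀ := Icc_subset_Icc_right ht.2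
    have := intervalIntegral.integral_eq_sub_of_hasDerivAt_of_le ht.1
      ((h.solution.continuousOn z hzI m hm).mono hsub)
      (f' := fun s => galerkinDeriv L R Iz Φ b Λ c [] s z m) (fun s hs => by
        have h1 := h.solution.equation s ⟨hs.1, hs.2.trans_le ht.2⟩ z hzI m hm
        rw [e1, ← fourierCoefficient_collision h.pos (c s z) hki m]
        exact h1)
      ((hc.mono hsub).intervalIntegrable_of_Icc ht.1)
    rw [this]
    simp [coeffDeriv]
  | cons i w ih =>
    have hw' : w.Pairwise (· ≤ ·) := (List.pairwise_cons.1 hw).2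
    have hlt : w.length < r := hr
    set μ := (volume.restrict (Ioc 0 t)).prod (collisionMeasure d R) with hμ
    have hd1 := differentiableOn_wordDeriv hS (h.solution.contDiffOn t ht m hm) hlt
    have hd0 := differentiableOn_wordDeriv hS (h.solution.contDiffOn 0 h0 m hm) hlt
    obtain ⟨C, hC⟩ := ae_prod_norm_galerkinIntegrand_le h hw hr m
    set F : ℝ × (EuclideanSpace ℝ (Fin d) × sphere (0 : EuclideanSpace ℝ (Fin d)) 1) →
      EuclideanSpace ℝ (Fin n) → ℂ := fun a => wordDeriv Iz w
        fun y => galerkinIntegrand L Iz Φ b Λ c [] y m a with hF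
    have hbase : ∀ a : ℝ × (EuclideanSpace ℝ (Fin d) × sphere (0 : EuclideanSpace ℝ (Fin d)) 1),
        a.1 ∈ Icc 0 t₀ → ContDiffOn ℝ r (fun y => galerkinIntegrand L Iz Φ b Λ c [] y m a) Iz := by
      intro a ha
      simp only [galerkinIntegrand, leibnizForm, splits, List.map_cons, List.map_nil,
        List.sum_cons, List.sum_nil, add_zero, galerkinForm, kernelDeriv, coeffDeriv, wordDeriv_nil]
      refine ContDiffOn.sum fun p hp => ContDiffOn.sum fun q hq => ?_
      split_ifs
      · exact ((contDiffOn_const.mul (contDiffOn_angularPart h.kernel a.2)).mul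
          contDiffOn_const).mul ((h.solution.contDiffOn a.1 ha p hp).mul
            (h.solution.contDiffOn a.1 ha q hq))
      · exact contDiffOn_const
    have hFeq : ∀ y ∈ Iz, ∀ᵐ a ∂μ, F a y = galerkinIntegrand L Iz Φ b Λ c w y m a := by
      intro y hy
      filter_upwards [hC t ht] with a ha
      exact wordDeriv_galerkinForm h hlt.le m ha.1 hy
    have key := partialWithin_eq_integral (μ := μ) (F := F) (S := Iz)
      (G := fun y => wordDeriv Iz w (fun y => c t y m) y - wordDeriv Iz w (fun y => c 0 y m) y)
      (fun y hy => (aestronglyMeasurable_galerkinIntegrand h hw' hlt.le ht hy m).congr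
        ((hFeq y (interior_subset hy)).mono fun a ha => ha.symm))
      (by filter_upwards [hC t ht] with a ha
          exact differentiableOn_wordDeriv hS (hbase a ha.1) hlt)
      (hd1.sub hd0)
      (fun y hy => by
        rw [integral_congr_ae (hFeq y (interior_subset hy)),
          ← (intervalIntegral_galerkinDeriv h hw' hlt.le ht hy m).2]
        have := ih hw' hlt.le hy
        simp only [coeffDeriv] at this
        rw [this, add_sub_cancel_left]) i (C := C)
      (by filter_upwards [hC t ht] with a ha y hy
          exact (congrArg norm (wordDeriv_galerkinForm h hr m ha.1 (interior_subset hy))).trans_le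
            (ha.2 y (interior_subset hy)))
      hz ((integrable_galerkinIntegrand h hw' hlt.le ht hz m).congr
        ((hFeq z (interior_subset hz)).mono fun a ha => ha.symm))
    have e2 : ∫ a, partialWithin Iz i (F a) z ∂μ
        = ∫ a, galerkinIntegrand L Iz Φ b Λ c (i :: w) z m a ∂μ := by
      refine integral_congr_ae ?_
      filter_upwards [hC t ht] with a ha
      exact wordDeriv_galerkinForm h hr m ha.1 (interior_subset hz)
    rw [e2, ← (intervalIntegral_galerkinDeriv h hw hr ht hz m).2] at key
    rw [← key]
    have hzI := interior_subset hz
    simp only [coeffDeriv, wordDeriv_cons, partialWithin]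
    rw [fderivWithin_fun_sub (hS z hzI) (hd1 z hzI) (hd0 z hzI)]
    simp

theorem continuousOn_coeffDeriv {X : ℝ}
    (h : BoundedSolution d r R L Iz M Cb Φ b Λ t₀ c X) (ht₀ : 0 ≤ t₀) {w : List (Fin n)}
    (hw : w.Pairwise (· ≤ ·)) (hr : w.length ≤ r)
    {z : EuclideanSpace ℝ (Fin n)} (hz : z ∈ interior Iz) {m : Fin d → ℤ} (hm : m ∈ Λ) :
    ContinuousOn (fun t => coeffDeriv Iz c w t z m) (Icc 0 t₀) := by
  have h1 := (intervalIntegral_galerkinDeriv h hw hr (t := t₀) ⟨ht₀, le_rfl⟩ hz m).1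
  have h2 : ContinuousOn (fun t => coeffDeriv Iz c w 0 z m
      + ∫ s in (0 : ℝ)..t, galerkinDeriv L R Iz Φ b Λ c w s z m) (Icc 0 t₀) := by
    rw [← uIcc_of_le ht₀]
    refine continuousOn_const.add (intervalIntegral.continuousOn_primitive_interval ?_)
    rwa [uIcc_of_le ht₀, integrableOn_Icc_iff_integrableOn_Ioc]
  exact h2.congr fun t ht => coeffDeriv_eq_add_integral h hw hr ht hz hm

theorem hasDerivWithinAt_coeffDeriv {X : ℝ}
    (h : BoundedSolution d r R L Iz M Cb Φ b Λ t₀ c X) {w : List (Fin n)}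
    (hw : w.Pairwise (· ≤ ·)) (hr : w.length ≤ r) {t : ℝ} (ht : t ∈ Ico 0 t₀)
    {z : EuclideanSpace ℝ (Fin n)} (hz : z ∈ interior Iz) {m : Fin d → ℤ} (hm : m ∈ Λ) :
    HasDerivWithinAt (fun t => coeffDeriv Iz c w t z m)
      (galerkinDeriv L R Iz Φ b Λ c w t z m) (Ici t) t := by
  have ht₀ : 0 ≤ t₀ := ht.1.trans ht.2.le
  have hc : ContinuousOn (fun s => galerkinDeriv L R Iz Φ b Λ c w s z m) (Icc 0 t₀) := by
    have hlist : ∀ {ι : Type} (l : List ι) (f : ι → ℝ → ℂ),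
        (∀ j ∈ l, ContinuousOn (f j) (Icc 0 t₀)) →
        ContinuousOn (fun s => (l.map fun j => f j s).sum) (Icc 0 t₀) := by
      intro ι l f hf
      induction l with
      | nil => simpa using continuousOn_const
      | cons j l ih =>
        simp only [List.map_cons, List.sum_cons]
        exact (hf j List.mem_cons_self).add (ih fun b hb => hf b (List.mem_cons_of_mem _ hb))
    refine hlist _ _ fun p hp => hlist _ _ fun q hq => ?_
    obtain ⟨h1, h2⟩ := sorted_of_mem_splits hw hr hp
    obtain ⟨h3, h4⟩ := sorted_of_mem_splits h2.1 h2.2 hq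
    simp only [galerkinForm]
    refine continuousOn_finsetSum _ fun P hP => continuousOn_finsetSum _ fun Q hQ => ?_
    split_ifs
    · exact continuousOn_const.mul ((continuousOn_coeffDeriv h ht₀ h3.1 h3.2 hz hP).mul
        (continuousOn_coeffDeriv h ht₀ h4.1 h4.2 hz hQ))
    · exact continuousOn_const
  have hle : nhdsWithin t (Ioi t) ≤ nhdsWithin t (Icc 0 t₀) := by
    rw [← nhdsWithin_Ioc_eq_nhdsGT ht.2]
    exact nhdsWithin_mono _ fun s hs => ⟨ht.1.trans hs.1.le, hs.2⟩
  have hsub : Icc 0 t ⊆ Icc 0 t₀ := Icc_subset_Icc_right ht.2.le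
  have h1 : HasDerivWithinAt (fun u => ∫ s in (0 : ℝ)..u, galerkinDeriv L R Iz Φ b Λ c w s z m)
      (galerkinDeriv L R Iz Φ b Λ c w t z m) (Ici t) t :=
    intervalIntegral.integral_hasDerivWithinAt_right
      ((hc.mono hsub).intervalIntegrable_of_Icc ht.1)
      ((hc.stronglyMeasurableAtFilter_nhdsWithin measurableSet_Icc t).filter_mono hle)
      ((hc t ⟨ht.1, ht.2.le⟩).mono_left hle)
  refine (h1.const_add (coeffDeriv Iz c w 0 z m)).congr_of_eventuallyEq ?_
    (coeffDeriv_eq_add_integral h hw hr ⟨ht.1, ht.2.le⟩ hz hm)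
  filter_upwards [Ico_mem_nhdsGE ht.2] with s hs
  exact coeffDeriv_eq_add_integral h hw hr ⟨ht.1.trans hs.1, hs.2.le⟩ hz hm

end

/-! ### A hierarchy of Grönwall estimates -/

section

theorem length_splits {α : Type*} (w : List α) : (splits w).length = 2 ^ w.length := by
  induction w with
  | nil => rfl
  | cons i w ih => simp [splits, ih, pow_succ, mul_two]

theorem list_sum_map_le_two_pow {α : Type*} {N : ℕ} (w : List α) (hw : w.length ≤ N)
    (f : List α × List α → ℝ) {B : ℝ} (hB : 0 ≤ B) (h : ∀ p ∈ splits w, f p ≤ B) :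
    ((splits w).map f).sum ≤ 2 ^ N * B := by
  have h1 := List.sum_le_card_nsmul ((splits w).map f) B fun x hx => by
    obtain ⟨p, hp, rfl⟩ := List.mem_map.1 hx
    exact h p hp
  rw [List.length_map, length_splits, nsmul_eq_mul] at h1
  refine h1.trans ?_
  push_cast
  gcongr
  norm_num

/-- Functions `X_{s,w}` of the time, indexed by pairs of words, whose derivatives are bounded by
products `‖X_{σ₁,q₁}‖₁ ‖X_{σ₂,q₂}‖` over the splittings of the words, where the weaker norm
`‖·‖₁ ≤ C₁ ‖·‖` of `X_{∅,∅}` is bounded by `E₀`. The bound on `X_{s,w}` follows by induction on the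
total length: in the highest order each product is linear in `X_{s,w}`. -/
theorem exists_bound_of_hierarchy {α β : Type*} {C₀ C₁ E₀ D₀ t₀ : ℝ} (hC₀ : 0 ≤ C₀) (hC₁ : 0 ≤ C₁)
    (hE₀ : 0 ≤ E₀) (hD₀ : 0 ≤ D₀) (P : List α → List β → Prop)
    (hP : ∀ s w s' w', P s w → s'.Sublist s → w'.Sublist w → P s' w') (N : ℕ) :
    ∃ K : ℝ, 0 ≤ K ∧ ∀ (V : Type) [NormedAddCommGroup V] [NormedSpace ℝ V]
      (X X' : List α → List β → ℝ → V) (ν : List α → List β → ℝ → ℝ),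
      (∀ s w, P s w → ContinuousOn (X s w) (Icc 0 t₀)) →
      (∀ s w, P s w → ∀ t ∈ Ico 0 t₀, HasDerivWithinAt (X s w) (X' s w t) (Ici t) t) →
      (∀ s w, P s w → ∀ t ∈ Ico 0 t₀, ‖X' s w t‖ ≤ ((splits s).map fun σ => ((splits w).map fun p =>
        ((splits p.2).map fun q => C₀ * ν σ.1 q.1 t * ‖X σ.2 q.2 t‖).sum).sum).sum) →
      (∀ s w, P s w → ∀ t ∈ Icc 0 t₀, 0 ≤ ν s w t ∧ ν s w t ≤ C₁ * ‖X s w t‖) →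
      (∀ t ∈ Icc 0 t₀, ν [] [] t ≤ E₀) →
      (∀ s w, P s w → ‖X s w 0‖ ≤ D₀) →
      ∀ s w, P s w → s.length + w.length < N → ∀ t ∈ Icc 0 t₀, ‖X s w t‖ ≤ K := by
  induction N with
  | zero => exact ⟨0, le_rfl, fun _ _ _ _ _ _ _ _ _ _ _ _ _ _ _ h => absurd h (by omega)⟩
  | succ N ih =>
    obtain ⟨K, hK, ih⟩ := ih
    set A := C₀ * (E₀ + C₁ * K) with hA
    set B := C₀ * (C₁ * K * K) with hB
    set T : ℝ := 2 ^ N * (2 ^ N * 2 ^ N) with hT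
    have hA0 : 0 ≤ A := by positivity
    have hB0 : 0 ≤ B := by positivity
    refine ⟨max K (gronwallBound D₀ (T * A) (T * B) t₀), le_max_of_le_left hK, ?_⟩
    intro V _ _ X X' ν hcont hderiv hX' hν hν0 h0 s w hsw hlen t ht
    have ihX := ih V X X' ν hcont hderiv hX' hν hν0 h0
    have hle : s.length ≤ N ∧ w.length ≤ N := by omega
    have hterm : ∀ τ ∈ Ico 0 t₀, ∀ σ ∈ splits s, ∀ p ∈ splits w, ∀ q ∈ splits p.2,
        C₀ * ν σ.1 q.1 τ * ‖X σ.2 q.2 τ‖ ≤ A * ‖X s w τ‖ + B := by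
      intro τ hτ σ hσ p hp q hq
      have hτ' : τ ∈ Icc 0 t₀ := ⟨hτ.1, hτ.2.le⟩
      obtain ⟨hs1, hs2⟩ := sublist_of_mem_splits hσ
      obtain ⟨hq1, hq2⟩ := sublist_of_mem_splits hq
      have hpw := (sublist_of_mem_splits hp).2
      have ls := length_add_length_of_mem_splits hσ
      have lq := length_add_length_of_mem_splits hq
      have lp := hpw.length_le
      have P1 := hP s w _ _ hsw hs1 (hq1.trans hpw)
      have P2 := hP s w _ _ hsw hs2 (hq2.trans hpw)
      have n1 := hν _ _ P1 τ hτ'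
      have hx := norm_nonneg (X s w τ)
      have hx2 := norm_nonneg (X σ.2 q.2 τ)
      by_cases c2 : σ.2.length + q.2.length < s.length + w.length
      · have b2 := ihX _ _ P2 (by omega) τ hτ'
        by_cases c1 : σ.1.length + q.1.length < s.length + w.length
        · have b1 := ihX _ _ P1 (by omega) τ hτ'
          calc C₀ * ν σ.1 q.1 τ * ‖X σ.2 q.2 τ‖
              ≤ C₀ * (C₁ * K) * K := by
                gcongr
                exact n1.2.trans (by gcongr)
            _ = B := by rw [hB]; ring
            _ ≤ _ := le_add_of_nonneg_left (by positivity)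
        · have e1 : σ.1 = s := hs1.eq_of_length (by omega)
          have e2 : q.1 = w := (hq1.trans hpw).eq_of_length (by omega)
          rw [e1, e2] at n1 ⊢
          calc C₀ * ν s w τ * ‖X σ.2 q.2 τ‖
              ≤ C₀ * (C₁ * ‖X s w τ‖) * K := by
                gcongr
                exact n1.2
            _ = C₀ * (C₁ * K) * ‖X s w τ‖ := by ring
            _ ≤ A * ‖X s w τ‖ := by
                rw [hA]
                gcongr
                exact le_add_of_nonneg_left hE₀
            _ ≤ _ := le_add_of_nonneg_right hB0
      · have e1 : σ.2 = s := hs2.eq_of_length (by omega)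
        have e2 : q.2 = w := (hq2.trans hpw).eq_of_length (by omega)
        have e3 : σ.1 = [] := List.length_eq_zero_iff.1 (by omega)
        have e4 : q.1 = [] := List.length_eq_zero_iff.1 (by omega)
        rw [e1, e2, e3, e4]
        calc C₀ * ν [] [] τ * ‖X s w τ‖ ≤ C₀ * E₀ * ‖X s w τ‖ := by
              gcongr
              exact hν0 τ hτ'
          _ ≤ A * ‖X s w τ‖ := by
              rw [hA]
              gcongr
              exact le_add_of_nonneg_right (by positivity)
          _ ≤ _ := le_add_of_nonneg_right hB0
    have hbound : ∀ τ ∈ Ico 0 t₀, ‖X' s w τ‖ ≤ T * A * ‖X s w τ‖ + T * B := by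
      intro τ hτ
      have hx := norm_nonneg (X s w τ)
      refine (hX' s w hsw τ hτ).trans ?_
      calc _ ≤ 2 ^ N * (2 ^ N * (2 ^ N * (A * ‖X s w τ‖ + B))) := by
            refine list_sum_map_le_two_pow s hle.1 _ (by positivity) fun σ hσ =>
              list_sum_map_le_two_pow w hle.2 _ (by positivity) fun p hp =>
              list_sum_map_le_two_pow p.2 ?_ _ (by positivity) fun q hq => hterm τ hτ σ hσ p hp q hq
            exact (sublist_of_mem_splits hp).2.length_le.trans hle.2
        _ = _ := by rw [hT]; ring
    have hg := norm_le_gronwallBound_of_norm_deriv_right_le (hcont s w hsw) (hderiv s w hsw)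
      (h0 s w hsw) hbound t ht
    rw [sub_zero] at hg
    exact hg.trans ((gronwallBound_mono hD₀ (by positivity) (by positivity) ht.2).trans
      (le_max_right _ _))

end

/-! ### Sobolev norms in terms of the Fourier coefficients -/

section norms

variable {d n r : ℕ} {L : ℝ}

/-- The factor `∏_{j ∈ s} i (π / L) m_j` by which the derivative `∂_v^s` acts on the mode `m`. -/
def freqFactor (L : ℝ) (s : List (Fin d)) (m : Fin d → ℤ) : ℂ :=
  (s.map fun j => Complex.I * ((Real.pi / L * m j : ℝ) : ℂ)).prod

theorem freqFactor_add (s : List (Fin d)) (p q : Fin d → ℤ) :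
    freqFactor L s (p + q)
      = ((splits s).map fun σ => freqFactor L σ.1 p * freqFactor L σ.2 q).sum := by
  simp only [freqFactor, ← prod_map_add_eq_sum_splits]
  congr 1
  refine List.map_congr_left fun j _ => ?_
  simp only [Pi.add_apply]
  push_cast
  ring

/-- Leibniz rule in the velocity, in terms of the coefficients. -/
theorem freqFactor_mul_galerkinForm (Λ : Finset (Fin d → ℤ))
    (β : (Fin d → ℤ) → (Fin d → ℤ) → ℂ) (x y : (Fin d → ℤ) → ℂ) (s : List (Fin d))
    (m : Fin d → ℤ) :
    freqFactor L s m * galerkinForm Λ β x y m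
      = ((splits s).map fun σ => galerkinForm Λ β (fun p => freqFactor L σ.1 p * x p)
          (fun q => freqFactor L σ.2 q * y q) m).sum := by
  simp only [galerkinForm_eq_sum_filter, list_sum_finset_sum, Finset.mul_sum]
  refine Finset.sum_congr rfl fun j hj => ?_
  rw [← (Finset.mem_filter.1 hj).2, freqFactor_add, ← List.sum_map_mul_right]
  refine congrArg List.sum (List.map_congr_left fun σ _ => ?_)
  ring

/-- The coefficients with frequencies in `Λ` as a vector of a Euclidean space. -/
def coeffVec (Λ : Finset (Fin d → ℤ)) (x : (Fin d → ℤ) → ℂ) : EuclideanSpace ℂ Λ :=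
  WithLp.toLp 2 fun m => x m

theorem norm_coeffVec (Λ : Finset (Fin d → ℤ)) (x : (Fin d → ℤ) → ℂ) :
    ‖coeffVec Λ x‖ = coeffNorm Λ x := by
  rw [EuclideanSpace.norm_eq, coeffNorm, ← Finset.sum_coe_sort Λ fun m => ‖x m‖ ^ 2]
  rfl

theorem coeffNorm_list_sum_le {ι : Type*} (Λ : Finset (Fin d → ℤ)) (l : List ι)
    (f : ι → (Fin d → ℤ) → ℂ) (g : ι → ℝ) (h : ∀ j ∈ l, coeffNorm Λ (f j) ≤ g j) :
    coeffNorm Λ (fun m => (l.map fun j => f j m).sum) ≤ (l.map g).sum := by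
  have e : coeffVec Λ (fun m => (l.map fun j => f j m).sum)
      = (l.map fun j => coeffVec Λ (f j)).sum := by
    clear h
    induction l with
    | nil => ext m; simp [coeffVec]
    | cons j l ih =>
      simp only [List.map_cons, List.sum_cons, ← ih]
      rfl
  rw [← norm_coeffVec, e]
  exact norm_list_sum_map_le _ _ _ fun j hj => (norm_coeffVec Λ (f j)).trans_le (h j hj)

theorem integral_norm_trigPoly_le (hL : 0 < L) (Λ : Finset (Fin d → ℤ)) (x : (Fin d → ℤ) → ℂ) :
    ∫ v in velocityBox d L, ‖trigPoly L Λ x v‖ ≤ (2 * L) ^ d * coeffNorm Λ x := by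
  have := isFiniteMeasure_velocityBox d hL
  have hn := coeffNorm_nonneg Λ x
  have h1 := lintegral_mul_le_sqrt (volume.restrict (velocityBox d L))
    (f := fun v => ‖trigPoly L Λ x v‖ₑ) (g := fun _ => 1) (by fun_prop) (by fun_prop)
  simp only [mul_one, one_pow, lintegral_const, one_mul, Measure.restrict_apply_univ,
    volume_velocityBox d hL, lintegral_enorm_sq_trigPoly hL] at h1
  rw [← ofReal_integral_norm_eq_lintegral_enorm
      (integrableOn_velocityBox (continuous_trigPoly Λ x)),
    ENNReal.ofReal_rpow_of_nonneg (by positivity) (by positivity),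
    ENNReal.ofReal_rpow_of_nonneg (by positivity) (by positivity),
    ← ENNReal.ofReal_mul (by positivity), ENNReal.ofReal_le_ofReal_iff (by positivity),
    ← Real.sqrt_eq_rpow, ← Real.sqrt_eq_rpow, Real.sqrt_mul (by positivity),
    Real.sqrt_sq hn] at h1
  refine h1.trans_eq ?_
  rw [mul_right_comm, Real.mul_self_sqrt (by positivity)]

theorem normLp_one_trigPoly (Λ : Finset (Fin d → ℤ)) (x : (Fin d → ℤ) → ℂ) :
    normLp L 1 (trigPoly L Λ x)
      = ENNReal.ofReal (∫ v in velocityBox d L, ‖trigPoly L Λ x v‖) := by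
  rw [normLp, eLpNorm_one_eq_lintegral_enorm, ofReal_integral_norm_eq_lintegral_enorm
    (integrableOn_velocityBox (continuous_trigPoly Λ x))]

theorem norm_coeff_le_integral (hL : 0 < L) (Λ : Finset (Fin d → ℤ)) (x : (Fin d → ℤ) → ℂ)
    {m : Fin d → ℤ} (hm : m ∈ Λ) :
    (2 * L) ^ d * ‖x m‖ ≤ ∫ v in velocityBox d L, ‖trigPoly L Λ x v‖ := by
  have h1 := norm_integral_le_integral_norm (μ := volume.restrict (velocityBox d L))
    (fun v => trigPoly L Λ x v * (starRingEnd ℂ) (fourierMode L m v))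
  rw [integral_trigPoly_mul_conj hL Λ x hm] at h1
  simp only [norm_mul, RCLike.norm_conj, norm_fourierMode, mul_one, Complex.norm_real] at h1
  rwa [Real.norm_of_nonneg (by positivity)] at h1

theorem differentiable_fourierMode (m : Fin d → ℤ) : Differentiable ℝ (fourierMode L m) := by
  unfold fourierMode
  fun_prop

theorem partialWithin_fourierMode (j : Fin d) (m : Fin d → ℤ) (v : EuclideanSpace ℝ (Fin d)) :
    partialWithin univ j (fourierMode L m) v
      = Complex.I * ((Real.pi / L * m j : ℝ) : ℂ) * fourierMode L m v := by
  have h1 := hasDerivAt_comp_add_single (S := univ)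
    (differentiable_fourierMode (L := L) m).differentiableOn j (z := v) (τ := 0) (by simp)
  have e : ∀ τ : ℝ, fourierMode L m (v + τ • EuclideanSpace.single j (1 : ℝ))
      = fourierMode L m v * Complex.exp (Complex.I * ((Real.pi / L * m j : ℝ) : ℂ) * (τ : ℂ)) :=
    fun τ => by
      rw [fourierMode_add]
      congr 1
      simp only [fourierMode, PiLp.smul_apply, PiLp.single_apply, smul_eq_mul, mul_ite, mul_one,
        mul_zero, Finset.sum_ite_eq', Finset.mem_univ, if_true]
      congr 1
      push_cast
      ring
  simp only [e, zero_smul, add_zero] at h1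
  have h2 : HasDerivAt (fun τ : ℝ => fourierMode L m v *
      Complex.exp (Complex.I * ((Real.pi / L * m j : ℝ) : ℂ) * (τ : ℂ)))
      (fourierMode L m v *
        (Complex.exp (Complex.I * ((Real.pi / L * m j : ℝ) : ℂ) * ((0 : ℝ) : ℂ)) *
        (Complex.I * ((Real.pi / L * m j : ℝ) : ℂ) * 1))) 0 :=
    (((Complex.ofRealCLM.hasDerivAt (x := (0 : ℝ))).const_mul _).cexp).const_mul _
  rw [h1.unique h2]
  simp
  ring

theorem wordDeriv_trigPoly (Λ : Finset (Fin d → ℤ)) (x : (Fin d → ℤ) → ℂ) (s : List (Fin d)) :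
    wordDeriv univ s (trigPoly L Λ x) = trigPoly L Λ fun m => freqFactor L s m * x m := by
  induction s with
  | nil => simp [freqFactor]
  | cons j s ih =>
    funext v
    rw [wordDeriv_cons, ih]
    have hd : ∀ m, DifferentiableOn ℝ (fourierMode L m) (univ : Set (EuclideanSpace ℝ (Fin d))) :=
      fun m => (differentiable_fourierMode m).differentiableOn
    have h1 := partialWithin_sum uniqueDiffOn_univ (mem_univ v) j Λ
      (fun m v => freqFactor L s m * x m * fourierMode L m v) fun m _ => (hd m).const_mul _
    refine h1.trans (Finset.sum_congr rfl fun m _ => ?_)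
    rw [partialWithin_const_mul uniqueDiffOn_univ (mem_univ v) j _ (hd m),
      partialWithin_fourierMode]
    simp only [freqFactor, List.map_cons, List.prod_cons]
    ring

theorem normHk_trigPoly (hL : 0 < L) (k : ℕ) (Λ : Finset (Fin d → ℤ)) (x : (Fin d → ℤ) → ℂ) :
    normHk L k (trigPoly L Λ x) = (∑ ν ∈ multiIdx d k, ENNReal.ofReal (√((2 * L) ^ d) *
      coeffNorm Λ fun m => freqFactor L (wordOf ν) m * x m) ^ 2) ^ (1 / 2 : ℝ) := by
  rw [normHk]
  simp only [multiDeriv_eq_wordDeriv, wordDeriv_trigPoly, normLp_two_trigPoly hL]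

theorem ofReal_coeffNorm_le_normHk (hL : 0 < L) {k : ℕ} (Λ : Finset (Fin d → ℤ))
    (x : (Fin d → ℤ) → ℂ) {s : List (Fin d)} (hs : s.Pairwise (· ≤ ·)) (hk : s.length ≤ k) :
    ENNReal.ofReal (√((2 * L) ^ d) * coeffNorm Λ fun m => freqFactor L s m * x m)
      ≤ normHk L k (trigPoly L Λ x) := by
  obtain ⟨ν, rfl⟩ := exists_eq_wordOf hs
  rw [normHk_trigPoly hL]
  set f : (Fin d → ℕ) → ℝ≥0∞ := fun ν => ENNReal.ofReal (√((2 * L) ^ d) *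
    coeffNorm Λ fun m => freqFactor L (wordOf ν) m * x m) with hf
  have h1 : f ν ^ 2 ≤ ∑ ν ∈ multiIdx d k, f ν ^ 2 :=
    Finset.single_le_sum (f := fun ν => f ν ^ 2) (fun _ _ => zero_le)
      (mem_multiIdx.2 (by rwa [← length_wordOf]))
  calc f ν = (f ν ^ 2) ^ (1 / 2 : ℝ) := by
        rw [← ENNReal.rpow_natCast, ← ENNReal.rpow_mul]
        norm_num
    _ ≤ _ := ENNReal.rpow_le_rpow h1 (by norm_num)

variable {Iz : Set (EuclideanSpace ℝ (Fin n))}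

theorem zDeriv_truncatedSeries (hIz : UniqueDiffOn ℝ Iz) {Λ : Finset (Fin d → ℤ)}
    {c : ℝ → EuclideanSpace ℝ (Fin n) → (Fin d → ℤ) → ℂ} {t : ℝ}
    (hc : ∀ m ∈ Λ, ContDiffOn ℝ r (fun z => c t z m) Iz) {l : Fin n → ℕ} (hl : l ∈ multiIdx n r)
    {z : EuclideanSpace ℝ (Fin n)} (hz : z ∈ Iz) :
    (fun v => zDeriv Iz l (truncatedSeries L Λ c t) v z)
      = trigPoly L Λ (coeffDeriv Iz c (wordOf l) t z) := by
  funext v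
  have hlen : (wordOf l).length ≤ r := by rwa [length_wordOf, ← mem_multiIdx]
  have e : truncatedSeries L Λ c t v = fun y => ∑ m ∈ Λ, fourierMode L m v * c t y m := by
    funext y
    exact Finset.sum_congr rfl fun m _ => mul_comm _ _
  rw [zDeriv, multiDeriv_eq_wordDeriv, e, wordDeriv_sum_const_mul hIz Λ _ _ hc hlen hz]
  exact Finset.sum_congr rfl fun m _ => mul_comm _ _

end norms

/-! ### The uniform bound -/

section bound

variable {d n r k : ℕ} {R L : ℝ} {Iz : Set (EuclideanSpace ℝ (Fin n))} {M Cb : ℝ≥0}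
  {Φ : ℝ → ℝ} {b : ℝ → EuclideanSpace ℝ (Fin n) → ℝ} {Λ : Finset (Fin d → ℤ)} {t₀ : ℝ}
  {c : ℝ → EuclideanSpace ℝ (Fin n) → (Fin d → ℤ) → ℂ}

/-- The coefficients of `∂_v^s ∂_z^w f_N`. -/
def mixedCoeff (L : ℝ) (Iz : Set (EuclideanSpace ℝ (Fin n)))
    (c : ℝ → EuclideanSpace ℝ (Fin n) → (Fin d → ℤ) → ℂ) (s : List (Fin d)) (w : List (Fin n))
    (t : ℝ) (z : EuclideanSpace ℝ (Fin n)) (m : Fin d → ℤ) : ℂ :=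
  freqFactor L s m * coeffDeriv Iz c w t z m

/-- The bilinear estimate for every term of the Leibniz expansion in `v` and `z`. -/
theorem coeffNorm_freqFactor_mul_galerkinDeriv_le {X : ℝ} (hd : d ≠ 0)
    (h : BoundedSolution d r R L Iz M Cb Φ b Λ t₀ c X) (s : List (Fin d)) {w : List (Fin n)}
    (hw : w.Pairwise (· ≤ ·)) (hr : w.length ≤ r) (t : ℝ)
    {z : EuclideanSpace ℝ (Fin n)} (hz : z ∈ interior Iz) :
    coeffNorm Λ (fun m => freqFactor L s m * galerkinDeriv L R Iz Φ b Λ c w t z m)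
      ≤ ((splits s).map fun σ => ((splits w).map fun p => ((splits p.2).map fun q =>
        (M * (2 * Cb) * bilinearConst d) *
          (∫ v in velocityBox d L, ‖trigPoly L Λ (mixedCoeff L Iz c σ.1 q.1 t z) v‖) *
          coeffNorm Λ (mixedCoeff L Iz c σ.2 q.2 t z)).sum).sum).sum := by
  have e : (fun m => freqFactor L s m * galerkinDeriv L R Iz Φ b Λ c w t z m)
      = fun m => ((splits s).map fun σ => ((splits w).map fun p => ((splits p.2).map fun q =>
        galerkinForm Λ (galerkinCoeff L R (kernelDeriv Iz Φ b p.1 z))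
          (mixedCoeff L Iz c σ.1 q.1 t z) (mixedCoeff L Iz c σ.2 q.2 t z) m).sum).sum).sum := by
    have swap : ∀ {ι κ : Type} (l : List ι) (l' : List κ) (f : ι → κ → ℂ),
        (l.map fun j => (l'.map fun i => f j i).sum).sum
          = (l'.map fun i => (l.map fun j => f j i).sum).sum := fun l l' f => by
      induction l with
      | nil => simp
      | cons j l ih => simp only [List.map_cons, List.sum_cons, ih, List.sum_map_add]
    funext m
    simp only [galerkinDeriv, leibnizForm, ← List.sum_map_mul_left, freqFactor_mul_galerkinForm]
    rw [swap (splits s)]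
    refine congrArg List.sum (List.map_congr_left fun p _ => ?_)
    rw [swap (splits s)]
    rfl
  rw [e]
  refine coeffNorm_list_sum_le _ _ _ _ fun σ _ => coeffNorm_list_sum_le _ _ _ _ fun p hp =>
    coeffNorm_list_sum_le _ _ _ _ fun q _ => ?_
  obtain ⟨h1, -⟩ := sorted_of_mem_splits hw hr hp
  exact coeffNorm_galerkinForm_le hd h.pos h.le (by positivity)
    (aestronglyMeasurable_kernelDeriv h.uniqueDiffOn h.kernel h1.2 hz)
    ((ae_norm_kernelDeriv_le h.uniqueDiffOn h.kernel h.le).mono fun ω hω =>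
      hω _ h1.1 h1.2 z (interior_subset hz)) Λ _ _

theorem exists_coeffNorm_bound (d n r k : ℕ) (hd : d ≠ 0) (R L : ℝ) (M Cb : ℝ≥0) (t₀ : ℝ)
    (hL : 0 < L) {E₀ D₀ : ℝ} (hE₀ : 0 ≤ E₀) (hD₀ : 0 ≤ D₀) :
    ∃ K : ℝ, 0 ≤ K ∧ ∀ (Iz : Set (EuclideanSpace ℝ (Fin n))) (Φ : ℝ → ℝ)
      (b : ℝ → EuclideanSpace ℝ (Fin n) → ℝ) (Λ : Finset (Fin d → ℤ))
      (c : ℝ → EuclideanSpace ℝ (Fin n) → (Fin d → ℤ) → ℂ) (X : ℝ),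
      BoundedSolution d r R L Iz M Cb Φ b Λ t₀ c X → ∀ z ∈ interior Iz,
      (∀ t ∈ Icc 0 t₀, ∫ v in velocityBox d L, ‖trigPoly L Λ (c t z) v‖ ≤ E₀) →
      (∀ (s : List (Fin d)) (w : List (Fin n)), s.Pairwise (· ≤ ·) → s.length ≤ k →
        w.Pairwise (· ≤ ·) → w.length ≤ r → coeffNorm Λ (mixedCoeff L Iz c s w 0 z) ≤ D₀) →
      ∀ (s : List (Fin d)) (w : List (Fin n)), s.Pairwise (· ≤ ·) → s.length ≤ k →
        w.Pairwise (· ≤ ·) → w.length ≤ r → ∀ t ∈ Icc 0 t₀,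
        coeffNorm Λ (mixedCoeff L Iz c s w t z) ≤ K := by
  have hb := bilinearConst_nonneg d
  obtain ⟨K, hK, H⟩ := exists_bound_of_hierarchy (α := Fin d) (β := Fin n)
    (C₀ := M * (2 * Cb) * bilinearConst d) (C₁ := (2 * L) ^ d) (t₀ := t₀)
    (by positivity) (by positivity) hE₀ hD₀
    (fun s w => (s.Pairwise (· ≤ ·) ∧ s.length ≤ k) ∧ w.Pairwise (· ≤ ·) ∧ w.length ≤ r)
    (fun s w s' w' h hs hw => ⟨⟨h.1.1.sublist hs, hs.length_le.trans h.1.2⟩,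
      h.2.1.sublist hw, hw.length_le.trans h.2.2⟩) (k + r + 1)
  refine ⟨K, hK, fun Iz Φ b Λ c X h z hz hE hD s w hs hsk hw hwr t ht => ?_⟩
  have ht₀ : 0 ≤ t₀ := ht.1.trans ht.2
  have := H (EuclideanSpace ℂ Λ) (fun s w t => coeffVec Λ (mixedCoeff L Iz c s w t z))
    (fun s w t => coeffVec Λ fun m => freqFactor L s m * galerkinDeriv L R Iz Φ b Λ c w t z m)
    (fun s w t => ∫ v in velocityBox d L, ‖trigPoly L Λ (mixedCoeff L Iz c s w t z) v‖)
    (fun s w hsw => (PiLp.continuous_toLp 2 _).comp_continuousOn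
      (continuousOn_pi.2 fun m => continuousOn_const.mul
        (continuousOn_coeffDeriv h ht₀ hsw.2.1 hsw.2.2 hz m.2)))
    (fun s w hsw t ht => ((PiLp.continuousLinearEquiv 2 ℝ fun _ : Λ => ℂ).symm
      |>.hasFDerivAt.comp_hasDerivWithinAt t (hasDerivWithinAt_pi.2 fun m =>
        (hasDerivWithinAt_coeffDeriv h hsw.2.1 hsw.2.2 ht hz m.2).const_mul (freqFactor L s m))))
    (fun s w hsw t ht => by
      simp only [norm_coeffVec]
      exact coeffNorm_freqFactor_mul_galerkinDeriv_le hd h s hsw.2.1 hsw.2.2 t hz)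
    (fun s w hsw t ht => ⟨integral_nonneg fun _ => norm_nonneg _, by
      rw [norm_coeffVec]
      exact integral_norm_trigPoly_le hL Λ _⟩)
    (fun t ht => by
      have e : mixedCoeff L Iz c [] [] t z = c t z := by
        funext m; simp [mixedCoeff, freqFactor, coeffDeriv]
      rw [e]
      exact hE t ht)
    (fun s w hsw => by
      rw [norm_coeffVec]
      exact hD s w hsw.1.1 hsw.1.2 hsw.2.1 hsw.2.2)
    s w ⟨⟨hs, hsk⟩, hw, hwr⟩ (by omega) t ht
  rwa [norm_coeffVec] at this

/-- The bound on `[0, t₀]` for the families of the derivatives, at all points of `Iz`: the bound at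
interior points extends by continuity of the derivatives. -/
theorem exists_normHk_bound (d n r k : ℕ) (hd : d ≠ 0) (R L : ℝ) (hR : 0 < R) (hRL : R ≤ L)
    (M Cb : ℝ≥0) (t₀ : ℝ) (E D : (Fin n → ℕ) → ℝ≥0) : ∃ K : ℝ≥0,
      ∀ (Iz : Set (EuclideanSpace ℝ (Fin n))), UniqueDiffOn ℝ Iz → Iz ⊆ closure (interior Iz) →
      ∀ (Φ : ℝ → ℝ) (b : ℝ → EuclideanSpace ℝ (Fin n) → ℝ),
        KernelAssumptions d r R L Iz M Cb Φ b →
      ∀ (Λ : Finset (Fin d → ℤ)) (c : ℝ → EuclideanSpace ℝ (Fin n) → (Fin d → ℤ) → ℂ),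
        IsNumericalSolution r R L Iz Φ b Λ t₀ c →
        (∀ l ∈ multiIdx n r, ∀ z ∈ Iz,
          normHk L k (fun v => zDeriv Iz l (truncatedSeries L Λ c 0) v z) ≤ D l) →
        (∀ l ∈ multiIdx n r, ∀ t ∈ Icc 0 t₀, ∀ z ∈ Iz,
          normLp L 1 (fun v => zDeriv Iz l (truncatedSeries L Λ c t) v z) ≤ E l) →
        ∀ l ∈ multiIdx n r, ∀ t ∈ Icc 0 t₀, ∀ z ∈ Iz,
          normHk L k (fun v => zDeriv Iz l (truncatedSeries L Λ c t) v z) ≤ K := by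
  have hL : 0 < L := hR.trans_le hRL
  set V := √((2 * L) ^ d) with hV
  have hVpos : 0 < V := by positivity
  set D₀ : ℝ := (∑ l ∈ multiIdx n r, D l : ℝ≥0) / V with hD₀
  obtain ⟨K, hK, H⟩ := exists_coeffNorm_bound d n r k hd R L M Cb t₀ hL
    (E₀ := E fun _ => 0) (D₀ := D₀) (E _).2 (by positivity)
  set B : ℝ≥0∞ := (∑ _ν ∈ multiIdx d k, ENNReal.ofReal (V * K) ^ 2) ^ (1 / 2 : ℝ) with hB
  have hBtop : B ≠ ⊤ := ENNReal.rpow_ne_top_of_nonneg (by norm_num)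
    (ENNReal.sum_ne_top.2 fun _ _ => ENNReal.pow_ne_top ENNReal.ofReal_ne_top)
  refine ⟨B.toNNReal, ?_⟩
  intro Iz hIz hcl Φ b hKer Λ c hsol hinit hL1 l hl t ht z hz
  rw [ENNReal.coe_toNNReal hBtop]
  have ht₀ : 0 ≤ t₀ := ht.1.trans ht.2
  have h0mem : (0 : ℝ) ∈ Icc 0 t₀ := ⟨le_rfl, ht₀⟩
  -- the bounds in `L¹` control the coefficients and their derivatives
  have hE : ∀ l ∈ multiIdx n r, ∀ t ∈ Icc 0 t₀, ∀ z ∈ Iz,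
      ∫ v in velocityBox d L, ‖trigPoly L Λ (coeffDeriv Iz c (wordOf l) t z) v‖ ≤ E l := by
    intro l hl t ht z hz
    have := hL1 l hl t ht z hz
    rw [zDeriv_truncatedSeries hIz (hsol.contDiffOn t ht) hl hz, normLp_one_trigPoly] at this
    rw [← ENNReal.ofReal_coe_nnreal] at this
    exact (ENNReal.ofReal_le_ofReal_iff (E l).2).1 this
  have hbs : BoundedSolution d r R L Iz M Cb Φ b Λ t₀ c
      ((∑ l ∈ multiIdx n r, E l : ℝ≥0) / (2 * L) ^ d) := by
    refine ⟨hIz, hKer, hsol, hL, hRL, fun w hw hwr t ht z hz m hm => ?_⟩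
    obtain ⟨l, rfl⟩ := exists_eq_wordOf hw
    have hl : l ∈ multiIdx n r := by rwa [mem_multiIdx, ← length_wordOf]
    rw [le_div_iff₀' (by positivity)]
    refine (norm_coeff_le_integral hL Λ _ hm).trans ((hE l hl t ht z hz).trans ?_)
    exact_mod_cast Finset.single_le_sum (f := E) (fun _ _ => zero_le) hl
  have hint : ∀ y ∈ interior Iz, ∀ (s : List (Fin d)) (w : List (Fin n)), s.Pairwise (· ≤ ·) →
      s.length ≤ k → w.Pairwise (· ≤ ·) → w.length ≤ r →
      coeffNorm Λ (mixedCoeff L Iz c s w t y) ≤ K := by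
    intro y hy s w hs hsk hw hwr
    refine H Iz Φ b Λ c _ hbs y hy (fun τ hτ => ?_) (fun s w hs hsk hw hwr => ?_)
      s w hs hsk hw hwr t ht
    · have h0 : (fun _ => 0 : Fin n → ℕ) ∈ multiIdx n r := by simp [mem_multiIdx]
      have e : wordOf (fun _ => 0 : Fin n → ℕ) = [] := by simp [wordOf]
      have := hE _ h0 τ hτ y (interior_subset hy)
      rw [e] at this
      exact this
    · obtain ⟨l, rfl⟩ := exists_eq_wordOf hw
      have hl : l ∈ multiIdx n r := by rwa [mem_multiIdx, ← length_wordOf]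
      have h1 := hinit l hl y (interior_subset hy)
      rw [zDeriv_truncatedSeries hIz (hsol.contDiffOn 0 h0mem) hl (interior_subset hy)] at h1
      have h2 := (ofReal_coeffNorm_le_normHk hL Λ _ hs hsk).trans h1
      rw [← ENNReal.ofReal_coe_nnreal] at h2
      replace h2 := (ENNReal.ofReal_le_ofReal_iff (D l).2).1 h2
      rw [hD₀, le_div_iff₀' hVpos]
      refine h2.trans ?_
      exact_mod_cast Finset.single_le_sum (f := D) (fun _ _ => zero_le) hl
  rw [zDeriv_truncatedSeries hIz (hsol.contDiffOn t ht) hl hz, normHk_trigPoly hL]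
  refine ENNReal.rpow_le_rpow (Finset.sum_le_sum fun ν hν => ?_) (by norm_num)
  gcongr
  have hlen : (wordOf l).length ≤ r := by rwa [length_wordOf, ← mem_multiIdx]
  have hνk : (wordOf ν).length ≤ k := by rwa [length_wordOf, ← mem_multiIdx]
  have hcont : ContinuousOn (fun y => coeffNorm Λ (mixedCoeff L Iz c (wordOf ν) (wordOf l) t y))
      Iz := by
    refine Real.continuous_sqrt.comp_continuousOn (continuousOn_finsetSum _ fun m hm => ?_)
    refine ((continuousOn_const.mul ?_).norm).pow 2
    exact (contDiffOn_wordDeriv hIz (hsol.contDiffOn t ht m hm) (j := 0) hlen).continuousOn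
  exact ((hcont z hz).mono interior_subset).closure_le (hcl hz) continuousWithinAt_const
    fun y hy => hint y hy _ _ (pairwise_wordOf ν) hνk (pairwise_wordOf l) hlen

end bound

end SpectralBoltzmann

end

open SpectralBoltzmann in
theorem proposition4p2
    (d n r k : ℕ) (hd : 2 ≤ d) (R L : ℝ) (hR : 0 < R) (hRL : R ≤ L)
    (M Cb : ℝ≥0) (t₀ : ℝ) (ht₀ : 0 ≤ t₀) :
    (∀ E D : (Fin n → ℕ) → ℝ≥0, ∃ K : (Fin n → ℕ) → ℝ≥0,
      ∀ (Iz : Set (EuclideanSpace ℝ (Fin n))), UniqueDiffOn ℝ Iz → Iz ⊆ closure (interior Iz) →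
      ∀ (Φ : ℝ → ℝ) (b : ℝ → EuclideanSpace ℝ (Fin n) → ℝ),
        KernelAssumptions d r R L Iz M Cb Φ b →
      ∀ (Λ : Finset (Fin d → ℤ)) (c : ℝ → EuclideanSpace ℝ (Fin n) → (Fin d → ℤ) → ℂ),
        IsNumericalSolution r R L Iz Φ b Λ t₀ c →
        (∀ l ∈ multiIdx n r, ∀ z ∈ Iz,
          normHk L k (fun v => zDeriv Iz l (truncatedSeries L Λ c 0) v z) ≤ D l) →
        (∀ l ∈ multiIdx n r, ∀ t ∈ Icc 0 t₀, ∀ z ∈ Iz,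
          normLp L 1 (fun v => zDeriv Iz l (truncatedSeries L Λ c t) v z) ≤ E l) →
        ∀ l ∈ multiIdx n r, ∀ t ∈ Icc 0 t₀, ∀ z ∈ Iz,
          normHk L k (fun v => zDeriv Iz l (truncatedSeries L Λ c t) v z) ≤ K l) ∧
    (∀ E D : ℝ≥0, ∃ K : ℝ≥0,
      ∀ (Iz : Set (EuclideanSpace ℝ (Fin n))), UniqueDiffOn ℝ Iz → Iz ⊆ closure (interior Iz) →
      ∀ (Φ : ℝ → ℝ) (b : ℝ → EuclideanSpace ℝ (Fin n) → ℝ),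
        KernelAssumptions d r R L Iz M Cb Φ b →
      ∀ (Λ : Finset (Fin d → ℤ)) (c : ℝ → EuclideanSpace ℝ (Fin n) → (Fin d → ℤ) → ℂ),
        IsNumericalSolution r R L Iz Φ b Λ t₀ c →
        (∀ z ∈ Iz, normHkSum Iz L k r (truncatedSeries L Λ c 0) z ≤ D) →
        (∀ t ∈ Icc 0 t₀, ∀ z ∈ Iz, normLpSum Iz L 1 r (truncatedSeries L Λ c t) z ≤ E) →
        ∀ t ∈ Icc 0 t₀,
          (∀ z ∈ Iz, normHkSum Iz L k r (truncatedSeries L Λ c t) z ≤ K) ∧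
          supNormHkSum Iz L k r (truncatedSeries L Λ c t) ≤ K) := by
  refine ⟨fun E D => ?_, fun E D => ?_⟩
  · obtain ⟨K, hK⟩ := exists_normHk_bound d n r k (by omega) R L hR hRL M Cb t₀ E D
    exact ⟨fun _ => K, hK⟩
  · obtain ⟨K, hK⟩ := exists_normHk_bound d n r k (by omega) R L hR hRL M Cb t₀
      (fun _ => E) (fun _ => D)
    refine ⟨∑ _l ∈ multiIdx n r, K, ?_⟩
    intro Iz hIz hcl Φ b hKer Λ c hsol hinit hL1 t ht
    have h := hK Iz hIz hcl Φ b hKer Λ c hsol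
      (fun l hl z hz => (Finset.single_le_sum (f := fun l => normHk L k fun v =>
        zDeriv Iz l (truncatedSeries L Λ c 0) v z) (fun _ _ => zero_le) hl).trans (hinit z hz))
      (fun l hl t ht z hz => (Finset.single_le_sum (f := fun l => normLp L 1 fun v =>
        zDeriv Iz l (truncatedSeries L Λ c t) v z) (fun _ _ => zero_le) hl).trans (hL1 t ht z hz))
    rw [ENNReal.ofNNReal_finsetSum]
    exact ⟨fun z hz => Finset.sum_le_sum fun l hl => h l hl t ht z hz,
      Finset.sum_le_sum fun l hl => iSup₂_le fun z hz => h l hl t ht z hz⟩
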